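/- Let $\mathbb{S} = \{a^2+b^2 : a,b\in\mathbb{Z}\}$. For a prime $p \not\equiv 1 \pmod 4$ and a finite set $\mathbf{h}\subseteq\mathbb{Z}$ put $$\delta_{\mathbf{h}}(p) = \lim_{\alpha\to\infty} \frac{\#\{0\le a<p^{\alpha} : \text{for all } h\in\mathbf{h},\ a+h\equiv s \bmod p^{\alpha}\ \text{for some } s\in\mathbb{S}\}}{p^{\alpha}},$$ and define the singular series $$\mathfrak{S}_{\mathbf{h}} = \prod_{p\not\equiv 1 \bmod 4} \frac{\delta_{\mathbf{h}}(p)}{\big(\delta_{\{0\}}(p)\big)^{\#\mathbf{h}}},$$ the product being over all primes $p\not\equiv 1\pmod 4$ (including $p=2$), with value $0$ if $\delta_{\mathbf{h}}(p)=0$ for some such $p$. Let $\Delta^k=\{(x_1,\ldots,x_k)\in\mathbb{R}^k : 0<x_1<\cdots<x_k\}$. **Proposition.** Fix an integer $k\ge 1$ and a bounded convex set $\mathscr{C}\subseteq\Delta^k$, and let $\mathbf{o}=\emptyset$ or $\mathbf{o}=\{0\}$. As the real parameter $y\to\infty$, $$\sum_{(h_1,\ldots,h_k)\in y\mathscr{C}\cap\mathbb{Z}^k}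 \mathfrak{S}_{\mathbf{o}\cup\mathbf{h}} = y^k\Big(\mathrm{vol}(\mathscr{C}) + O\big(y^{-2/3+o(1)}\big)\Big),$$ where $\mathbf{h}=\{h_1,\ldots,h_k\}$ in the summand, $y\mathscr{C}=\{yx : x\in\mathscr{C}\}$, and $\mathrm{vol}$ is Lebesgue measure on $\mathbb{R}^k$; the implied constant and the quantity $o(1)$, which depends only on $y$ and tends to $0$ as $y\to\infty$, may depend on $k$, $\mathscr{C}$ and $\mathbf{o}$. -/

import Mathlib

open Filter Topology
open scoped Pointwise

namespace TwoSquares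

/-- The set `𝕊` of integers of the form `a² + b²` with `a, b ∈ ℤ`. -/
def sumsTwoSq : Set ℤ := {n | ∃ a b : ℤ, n = a ^ 2 + b ^ 2}

/-- The integer `n` is congruent to a sum of two squares modulo `N`. -/
def IsSumTwoSqMod (N : ℕ) (n : ℤ) : Prop := ∃ s ∈ sumsTwoSq, n ≡ s [ZMOD (N : ℤ)]

open Classical in
/-- The proportion of `0 ≤ a < p ^ α` such that, for every `h ∈ H`, the integer `a + h` is
congruent to a sum of two squares modulo `p ^ α`. -/
noncomputable def densityMod (H : Finset ℤ) (p α : ℕ) : ℝ :=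
  (((Finset.range (p ^ α)).filter
    (fun a : ℕ => ∀ h ∈ H, IsSumTwoSqMod (p ^ α) ((a : ℤ) + h))).card : ℝ) / (p : ℝ) ^ α

/-- The local density `δ_H(p) = lim_{α → ∞} densityMod H p α`. The limit exists, by
`tendsto_densityMod` below. -/
noncomputable def localDensity (H : Finset ℤ) (p : ℕ) : ℝ :=
  limUnder atTop (fun α : ℕ => densityMod H p α)

/-- The primes `p` that are not congruent to `1` modulo `4` (so `2` is included). -/
abbrev LocalPrime : Type := {p : ℕ // p.Prime ∧ ¬ p ≡ 1 [MOD 4]}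

/-- The singular series `𝔖_H = ∏_{p ≢ 1 mod 4} δ_H(p) / δ_{0}(p) ^ #H`. The product converges
unconditionally, by `multipliable_localFactor` below, and it is zero as soon as one of the local
densities `δ_H(p)` is zero, by `singularSeries_eq_zero` below. -/
noncomputable def singularSeries (H : Finset ℤ) : ℝ :=
  ∏' p : LocalPrime, localDensity H p / localDensity {0} p ^ H.card

/-- The region `Δᵏ = {(x₁, …, x_k) ∈ ℝᵏ : 0 < x₁ < ⋯ < x_k}`. -/
def orderedRegion (k : ℕ) : Set (Fin k → ℝ) := {x | (∀ i, 0 < x i) ∧ StrictMono x}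

/-- The integer points `(h₁, …, h_k) ∈ S ∩ ℤᵏ` of a set `S ⊆ ℝᵏ`. -/
def integerPoints {k : ℕ} (S : Set (Fin k → ℝ)) : Set (Fin k → ℤ) :=
  {h | (fun i => (h i : ℝ)) ∈ S}

theorem finite_integerPoints {k : ℕ} {C : Set (Fin k → ℝ)} (hC : Bornology.IsBounded C) (y : ℝ) :
    (integerPoints (y • C)).Finite := by
  obtain ⟨R, hR⟩ := (hC.smul₀ y).exists_norm_le
  refine (Set.Finite.pi' (fun _ : Fin k => Set.finite_Icc (-⌈R⌉) ⌈R⌉)).subset ?_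
  intro h hh i
  have h1 : |(h i : ℝ)| ≤ R := (norm_le_pi_norm (fun i => (h i : ℝ)) i).trans (hR _ hh)
  have h2 := abs_le.1 (h1.trans (Int.le_ceil R))
  constructor
  · exact_mod_cast h2.1
  · exact_mod_cast h2.2

theorem isSumTwoSqMod_congr {N : ℕ} {m n : ℤ} (h : m ≡ n [ZMOD (N : ℤ)]) :
    IsSumTwoSqMod N m ↔ IsSumTwoSqMod N n :=
  ⟨fun ⟨s, hs, e⟩ => ⟨s, hs, h.symm.trans e⟩, fun ⟨s, hs, e⟩ => ⟨s, hs, h.trans e⟩⟩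

theorem densityMod_nonneg (H : Finset ℤ) (p α : ℕ) : 0 ≤ densityMod H p α := by
  unfold densityMod; positivity

theorem antitone_densityMod (H : Finset ℤ) {p : ℕ} (hp : 0 < p) :
    Antitone (densityMod H p) := by
  classical
  refine antitone_nat_of_succ_le fun α => ?_
  have hp' : (0 : ℝ) < p := by exact_mod_cast hp
  unfold densityMod
  rw [div_le_div_iff₀ (by positivity) (by positivity), pow_succ (p : ℝ) α,
    mul_comm ((p : ℝ) ^ α) (p : ℝ), ← mul_assoc]
  refine mul_le_mul_of_nonneg_right ?_ (by positivity)
  rw [← Nat.cast_mul, Nat.cast_le]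
  refine le_trans (Finset.card_le_card_of_injOn (t := ((Finset.range (p ^ α)).filter
    (fun a : ℕ => ∀ h ∈ H, IsSumTwoSqMod (p ^ α) ((a : ℤ) + h))) ×ˢ Finset.range p)
    (fun a => (a % p ^ α, a / p ^ α)) ?_ ?_)
    (by rw [Finset.card_product, Finset.card_range])
  · intro a ha
    have ha := Finset.mem_filter.1 (Finset.mem_coe.1 ha)
    refine Finset.mem_coe.2 (Finset.mem_product.2 ⟨Finset.mem_filter.2 ⟨?_, ?_⟩, ?_⟩)
    · exact Finset.mem_range.2 (Nat.mod_lt _ (by positivity))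
    · intro h hh
      obtain ⟨s, hs, e⟩ := ha.2 h hh
      have hd : ((p ^ α : ℕ) : ℤ) ∣ ((p ^ (α + 1) : ℕ) : ℤ) := by
        exact_mod_cast pow_dvd_pow p (Nat.le_succ α)
      refine ⟨s, hs, Int.ModEq.trans ?_ (e.of_dvd hd)⟩
      refine Int.ModEq.add_right _ ?_
      push_cast
      exact Int.mod_modEq _ _
    · refine Finset.mem_range.2 (Nat.div_lt_of_lt_mul ?_)
      have := Finset.mem_range.1 ha.1
      rwa [pow_succ] at this
  · intro a _ b _ hab
    have h1 := congrArg Prod.fst hab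
    have h2 := congrArg Prod.snd hab
    simp only at h1 h2
    rw [← Nat.mod_add_div a (p ^ α), ← Nat.mod_add_div b (p ^ α), h1, h2]

/-- The limit that defines the local density exists. -/
theorem tendsto_densityMod (H : Finset ℤ) {p : ℕ} (hp : 0 < p) :
    Tendsto (fun α : ℕ => densityMod H p α) atTop (𝓝 (localDensity H p)) := by
  refine tendsto_nhds_limUnder ⟨_, tendsto_atTop_ciInf (antitone_densityMod H hp) ⟨0, ?_⟩⟩
  rintro _ ⟨α, rfl⟩
  exact densityMod_nonneg H p α

/-- The singular series vanishes if one of the local densities vanishes. -/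
theorem singularSeries_eq_zero (H : Finset ℤ) (p : LocalPrime) (h : localDensity H p = 0) :
    singularSeries H = 0 := by
  exact tprod_of_exists_eq_zero ⟨p, by simp [h]⟩

theorem isSumTwoSqMod_of_coprime {N : ℕ} (hN : N.Coprime 4) (hN0 : N ≠ 0) {n : ℕ}
    (hn : n.Coprime N) : IsSumTwoSqMod N n := by
  obtain ⟨m, hm1, hm2⟩ := Nat.chineseRemainder hN n 1
  have hc : m.Coprime (N * 4) := by
    refine Nat.Coprime.mul_right ?_ ?_
    · exact (Nat.ModEq.gcd_eq hm1).trans hn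
    · exact (Nat.ModEq.gcd_eq hm2).trans (by norm_num)
  obtain ⟨q, -, hq, hqm⟩ := Nat.forall_exists_prime_gt_and_modEq 0 (by positivity) hc
  have h4 : q ≡ 1 [MOD 4] := (hqm.of_dvd ⟨N, by ring⟩).trans hm2
  have hqN : q ≡ n [MOD N] := (hqm.of_dvd ⟨4, rfl⟩).trans hm1
  have := Fact.mk hq
  obtain ⟨a, b, hab⟩ := Nat.Prime.sq_add_sq (p := q) (by unfold Nat.ModEq at h4; omega)
  refine ⟨(q : ℤ), ⟨a, b, by exact_mod_cast hab.symm⟩, ?_⟩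
  exact_mod_cast (Int.natCast_modEq_iff.2 hqN.symm)

open Classical in
theorem card_bad_shift {N : ℕ} (hN : N ≠ 0) (h : ℤ) :
    ((Finset.range N).filter (fun a : ℕ => ¬ IsSumTwoSqMod N ((a : ℤ) + h))).card =
      ((Finset.range N).filter (fun a : ℕ => ¬ IsSumTwoSqMod N (a : ℤ))).card := by
  set P : ℕ → Prop := fun a => ¬ IsSumTwoSqMod N (a : ℤ) with hP
  have hper : Function.Periodic P N := by
    intro a
    refine propext (not_congr (isSumTwoSqMod_congr ?_))
    push_cast
    exact Int.add_modulus_modEq_iff.2 (Int.ModEq.refl _)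
  have hN' : (0 : ℤ) < N := by positivity
  obtain ⟨m, hm⟩ : ∃ m : ℕ, (m : ℤ) = h % N :=
    ⟨(h % N).toNat, Int.toNat_of_nonneg (Int.emod_nonneg _ hN'.ne')⟩
  have h1 := Nat.filter_Ico_card_eq_of_periodic m N P hper
  rw [Nat.count_eq_card_filter_range] at h1
  rw [← h1]
  refine Finset.card_bij (fun a _ => a + m) ?_ ?_ ?_
  · intro a ha
    obtain ⟨ha1, ha2⟩ := Finset.mem_filter.1 ha
    have := Finset.mem_range.1 ha1
    refine Finset.mem_filter.2 ⟨Finset.mem_Ico.2 ⟨by omega, by omega⟩, ?_⟩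
    refine fun hc => ha2 ((isSumTwoSqMod_congr ?_).1 hc)
    push_cast
    rw [hm]
    exact Int.ModEq.add_left _ (Int.mod_modEq _ _)
  · intro a _ b _ hab
    exact Nat.add_right_cancel hab
  · intro b hb
    obtain ⟨hb1, hb2⟩ := Finset.mem_filter.1 hb
    have := Finset.mem_Ico.1 hb1
    refine ⟨b - m, Finset.mem_filter.2 ⟨Finset.mem_range.2 (by omega), ?_⟩, by omega⟩
    refine fun hc => hb2 ((isSumTwoSqMod_congr ?_).1 hc)
    have e : ((b - m : ℕ) : ℤ) = b - m := by omega
    have e2 : (b : ℤ) = (b - m : ℤ) + m := by ring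
    have e3 : (m : ℤ) ≡ h [ZMOD (N : ℤ)] := by rw [hm]; exact Int.mod_modEq _ _
    rw [e]
    nth_rewrite 2 [e2]
    exact Int.ModEq.add_left _ e3.symm

theorem dvd_of_bad {p α : ℕ} (hp : p.Prime) (hp2 : p ≠ 2) {n : ℤ}
    (h : ¬ IsSumTwoSqMod (p ^ α) n) : (p : ℤ) ∣ n := by
  by_contra hd
  have hN : p ^ α ≠ 0 := pow_ne_zero _ hp.ne_zero
  have hN' : (0 : ℤ) < (p ^ α : ℕ) := by positivity
  rcases Nat.eq_zero_or_pos α with rfl | hα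
  · exact h ⟨0, ⟨0, 0, by norm_num⟩, by simpa using Int.modEq_one⟩
  obtain ⟨m, hm⟩ : ∃ m : ℕ, (m : ℤ) = n % (p ^ α : ℕ) :=
    ⟨(n % (p ^ α : ℕ)).toNat, Int.toNat_of_nonneg (Int.emod_nonneg _ hN'.ne')⟩
  have hmn : (m : ℤ) ≡ n [ZMOD ((p ^ α : ℕ) : ℤ)] := by rw [hm]; exact Int.mod_modEq _ _
  refine h ((isSumTwoSqMod_congr hmn).1 (isSumTwoSqMod_of_coprime ?_ hN ?_))
  · have : p.Coprime 2 := (Nat.coprime_primes hp Nat.prime_two).2 hp2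
    exact Nat.Coprime.pow_left _ (this.pow_right 2)
  · refine Nat.Coprime.pow_right _ (Nat.Coprime.symm ((Nat.Prime.coprime_iff_not_dvd hp).2 ?_))
    intro hpm
    refine hd ?_
    have hpd : (p : ℤ) ∣ ((p ^ α : ℕ) : ℤ) := by exact_mod_cast dvd_pow_self p hα.ne'
    exact (hmn.of_dvd hpd).dvd_iff.1 (by exact_mod_cast hpm)

open Classical in
theorem one_sub_densityMod (H : Finset ℤ) {p : ℕ} (hp : p.Prime) (hp2 : p ≠ 2)
    (hH : ∀ h ∈ H, ∀ h' ∈ H, h ≠ h' → ¬ (p : ℤ) ∣ h - h') (α : ℕ) :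
    1 - densityMod H p α = H.card * (((Finset.range (p ^ α)).filter
      (fun a : ℕ => ¬ IsSumTwoSqMod (p ^ α) (a : ℤ))).card / (p : ℝ) ^ α) := by
  have hp' : (0 : ℝ) < (p : ℝ) ^ α := by have := hp.pos; positivity
  have h1 := Finset.card_filter_add_card_filter_not (s := Finset.range (p ^ α))
    (fun a : ℕ => ∀ h ∈ H, IsSumTwoSqMod (p ^ α) ((a : ℤ) + h))
  rw [Finset.card_range] at h1
  have h2 : (Finset.range (p ^ α)).filter
      (fun a : ℕ => ¬ ∀ h ∈ H, IsSumTwoSqMod (p ^ α) ((a : ℤ) + h)) =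
      H.biUnion (fun h => (Finset.range (p ^ α)).filter
        (fun a : ℕ => ¬ IsSumTwoSqMod (p ^ α) ((a : ℤ) + h))) := by
    ext a
    simp only [Finset.mem_filter, Finset.mem_biUnion, not_forall]
    tauto
  have h3 : ((Finset.range (p ^ α)).filter
      (fun a : ℕ => ¬ ∀ h ∈ H, IsSumTwoSqMod (p ^ α) ((a : ℤ) + h))).card =
      H.card * ((Finset.range (p ^ α)).filter
      (fun a : ℕ => ¬ IsSumTwoSqMod (p ^ α) (a : ℤ))).card := by
    rw [h2, Finset.card_biUnion]
    · rw [Finset.sum_congr rfl (fun h _ => card_bad_shift (pow_ne_zero α hp.ne_zero) h),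
        Finset.sum_const, smul_eq_mul]
    · intro h hh h' hh' hne
      refine Finset.disjoint_left.2 fun a ha ha' => hH h hh h' hh' hne ?_
      have d1 := dvd_of_bad hp hp2 (Finset.mem_filter.1 ha).2
      have d2 := dvd_of_bad hp hp2 (Finset.mem_filter.1 ha').2
      simpa using dvd_sub d1 d2
  rw [h3] at h1
  have h4 : ((Finset.range (p ^ α)).filter
      (fun a : ℕ => ∀ h ∈ H, IsSumTwoSqMod (p ^ α) ((a : ℤ) + h))).card + (H.card : ℝ) *
      ((Finset.range (p ^ α)).filter
      (fun a : ℕ => ¬ IsSumTwoSqMod (p ^ α) (a : ℤ))).card = (p : ℝ) ^ α := by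
    exact_mod_cast h1
  unfold densityMod
  field_simp
  linarith

theorem one_sub_localDensity (H : Finset ℤ) {p : ℕ} (hp : p.Prime) (hp2 : p ≠ 2)
    (hH : ∀ h ∈ H, ∀ h' ∈ H, h ≠ h' → ¬ (p : ℤ) ∣ h - h') :
    1 - localDensity H p = H.card * (1 - localDensity {0} p) := by
  refine tendsto_nhds_unique ((tendsto_densityMod H hp.pos).const_sub 1) ?_
  refine (((tendsto_densityMod {0} hp.pos).const_sub 1).const_mul (H.card : ℝ)).congr fun α => ?_
  rw [one_sub_densityMod H hp hp2 hH, one_sub_densityMod {0} hp hp2 (by simp)]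
  simp

theorem one_sub_localDensity_zero_mem {p : ℕ} (hp : p.Prime) (hp2 : p ≠ 2) :
    1 - localDensity {0} p ∈ Set.Icc (0 : ℝ) (1 / p) := by
  classical
  refine isClosed_Icc.mem_of_tendsto ((tendsto_densityMod {0} hp.pos).const_sub 1)
    ((eventually_ge_atTop 1).mono fun α hα => ?_)
  have hp' : (0 : ℝ) < (p : ℝ) := by exact_mod_cast hp.pos
  rw [one_sub_densityMod {0} hp hp2 (by simp)]
  refine ⟨by positivity, ?_⟩
  obtain ⟨β, rfl⟩ := Nat.exists_eq_add_of_le' hα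
  have h1 : ((Finset.range (p ^ (β + 1))).filter
      (fun a : ℕ => ¬ IsSumTwoSqMod (p ^ (β + 1)) (a : ℤ))).card ≤ p ^ β := by
    conv_rhs => rw [← Finset.card_range (p ^ β)]
    refine Finset.card_le_card_of_injOn (fun a => a / p) ?_ ?_
    · intro a ha
      have ha := Finset.mem_filter.1 (Finset.mem_coe.1 ha)
      have := Finset.mem_range.1 ha.1
      rw [pow_succ'] at this
      exact Finset.mem_coe.2 (Finset.mem_range.2 (Nat.div_lt_of_lt_mul this))
    · intro a ha b hb hab
      have da : p ∣ a := by
        exact_mod_cast dvd_of_bad hp hp2 (Finset.mem_filter.1 (Finset.mem_coe.1 ha)).2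
      have db : p ∣ b := by
        exact_mod_cast dvd_of_bad hp hp2 (Finset.mem_filter.1 (Finset.mem_coe.1 hb)).2
      rw [← Nat.div_mul_cancel da, ← Nat.div_mul_cancel db]
      exact congrArg (· * p) hab
  have h2 : (((Finset.range (p ^ (β + 1))).filter
      (fun a : ℕ => ¬ IsSumTwoSqMod (p ^ (β + 1)) (a : ℤ))).card : ℝ) ≤ (p : ℝ) ^ β := by
    exact_mod_cast h1
  rw [Finset.card_singleton, Nat.cast_one, one_mul, div_le_div_iff₀ (by positivity) hp', one_mul,
    pow_succ]
  exact mul_le_mul_of_nonneg_right h2 hp'.le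

theorem abs_factor_sub_one_le (k : ℕ) {b : ℝ} (hb0 : 0 ≤ b) (hb : b ≤ 1 / 2) :
    |(1 - k * b) / (1 - b) ^ k - 1| ≤ 2 ^ k * (k : ℝ) ^ 2 * b ^ 2 := by
  have h1 : 1 - k * b ≤ (1 - b) ^ k := by
    have := one_add_mul_le_pow (a := -b) (by linarith) k
    calc 1 - k * b = 1 + k * (-b) := by ring
      _ ≤ (1 + -b) ^ k := this
      _ = (1 - b) ^ k := by ring
  have h2 : (1 - b) ^ k ≤ 1 - k * b + (k : ℝ) ^ 2 * b ^ 2 := by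
    clear h1
    induction k with
    | zero => simp
    | succ n ih =>
      have := mul_le_mul_of_nonneg_right ih (by linarith : (0 : ℝ) ≤ 1 - b)
      rw [pow_succ]
      push_cast
      have h3 : (0 : ℝ) ≤ (n : ℝ) ^ 2 * b ^ 3 := by positivity
      have h4 : (0 : ℝ) ≤ (n : ℝ) * b ^ 2 := by positivity
      have h5 : (0 : ℝ) ≤ b ^ 2 := by positivity
      nlinarith
  have h3 : (1 / 2 : ℝ) ^ k ≤ (1 - b) ^ k := pow_le_pow_left₀ (by norm_num) (by linarith) k
  have hpos : 0 < (1 - b) ^ k := lt_of_lt_of_le (by positivity) h3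
  have h6 : 1 ≤ 2 ^ k * (1 - b) ^ k := by
    have := mul_le_mul_of_nonneg_left h3 (by positivity : (0 : ℝ) ≤ 2 ^ k)
    rwa [← mul_pow, show (2 : ℝ) * (1 / 2) = 1 by norm_num, one_pow] at this
  have e : (1 - k * b) / (1 - b) ^ k - 1 = -(((1 - b) ^ k - (1 - k * b)) / (1 - b) ^ k) := by
    field_simp
    ring
  rw [e, abs_neg, abs_of_nonneg (div_nonneg (by linarith) hpos.le), div_le_iff₀ hpos]
  calc (1 - b) ^ k - (1 - k * b) ≤ 1 * ((k : ℝ) ^ 2 * b ^ 2) := by linarith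
    _ ≤ (2 ^ k * (1 - b) ^ k) * ((k : ℝ) ^ 2 * b ^ 2) :=
      mul_le_mul_of_nonneg_right h6 (by positivity)
    _ = _ := by ring

/-- The product that defines the singular series converges unconditionally. -/
theorem multipliable_localFactor (H : Finset ℤ) :
    Multipliable (fun p : LocalPrime => localDensity H p / localDensity {0} p ^ H.card) := by
  have hs : Summable (fun p : LocalPrime => 2 ^ H.card * (H.card : ℝ) ^ 2 * (1 / (p : ℝ)) ^ 2) := by
    refine Summable.mul_left _ ?_
    have : Summable (fun n : ℕ => (1 / (n : ℝ)) ^ 2) := by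
      refine (Real.summable_one_div_nat_pow.2 one_lt_two).congr fun n => ?_
      rw [div_pow, one_pow]
    exact this.comp_injective Subtype.val_injective
  have hb : ∀ᶠ p : LocalPrime in cofinite,
      ‖localDensity H p / localDensity {0} p ^ H.card - 1‖ ≤
        2 ^ H.card * (H.card : ℝ) ^ 2 * (1 / (p : ℝ)) ^ 2 := by
    obtain ⟨M, hM⟩ : ∃ M : ℕ, ∀ h ∈ H, ∀ h' ∈ H, (h - h').natAbs ≤ M := by
      refine ⟨(H ×ˢ H).sup (fun x => (x.1 - x.2).natAbs), fun h hh h' hh' => ?_⟩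
      exact Finset.le_sup (f := fun x : ℤ × ℤ => (x.1 - x.2).natAbs)
        (Finset.mem_product.2 ⟨hh, hh'⟩ : (h, h') ∈ H ×ˢ H)
    have hfin : {p : LocalPrime | (p : ℕ) ≤ max M 2}.Finite :=
      (Set.finite_Iic (max M 2)).preimage Subtype.val_injective.injOn
    filter_upwards [hfin.compl_mem_cofinite] with p hp
    have hp3 : max M 2 < (p : ℕ) := not_le.1 hp
    have hpp := p.2.1
    have hp2 : (p : ℕ) ≠ 2 := by have := le_max_right M 2; omega
    have hH : ∀ h ∈ H, ∀ h' ∈ H, h ≠ h' → ¬ ((p : ℕ) : ℤ) ∣ h - h' := by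
      intro h hh h' hh' hne hd
      have := Nat.le_of_dvd (Int.natAbs_pos.2 (sub_ne_zero.2 hne)) (Int.natCast_dvd.1 hd)
      have := hM h hh h' hh'
      have := le_max_left M 2
      omega
    have e1 := one_sub_localDensity H hpp hp2 hH
    obtain ⟨m1, m2⟩ := one_sub_localDensity_zero_mem hpp hp2
    set b := 1 - localDensity {0} p with hbdef
    have e2 : localDensity H p = 1 - H.card * b := by linarith
    have e3 : localDensity {0} p = 1 - b := by rw [hbdef]; ring
    have hp2' : (2 : ℝ) ≤ (p : ℕ) := by exact_mod_cast hpp.two_le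
    have hhalf : b ≤ 1 / 2 := m2.trans (one_div_le_one_div_of_le (by norm_num) hp2')
    rw [e2, e3, Real.norm_eq_abs]
    refine (abs_factor_sub_one_le _ m1 hhalf).trans ?_
    exact mul_le_mul_of_nonneg_left (pow_le_pow_left₀ m1 m2 2)
      (mul_nonneg (pow_nonneg zero_le_two _) (sq_nonneg _))
  have hsum : Summable (fun p : LocalPrime =>
      ‖localDensity H p / localDensity {0} p ^ H.card - 1‖) := by
    refine Summable.of_norm_bounded_eventually hs ?_
    filter_upwards [hb] with p hp
    rw [norm_norm]
    exact hp
  exact (multipliable_one_add_of_summable hsum).congr fun p => add_sub_cancel _ _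

end TwoSquares

/-! Let K be the number of points of `o ∪ h`. At each prime the factor δ_h(p)/δ_0(p)^K is the limit
of approximations `levelFactor p j` computed modulo p^j, which telescope into increments `levelIncr
p j` starting from the value 1 at j = 0. Multiplying out over finitely many primes writes the
truncated singular series as a sum over moduli d = ∏ p^(f p) of products of increments, each product
being periodic modulo d in h.

Two facts control these terms. First, when h runs over all residues, the residues a + h_i become
independent, so `levelFactor` has mean exactly 1 and every increment of level j ≥ 1 has mean zero
(`meanBox_levelIncr`). By the Chinese remainder theorem only d = 1 survives, and it gives the main
term. Secondly, an increment of level j ≥ 1 is O(p^(-j)) times (1/p, plus 1 if two points agree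
modulo p) (`abs_levelIncr_le`). For odd p without such a collision the factor is (1 - Kb)/(1 - b)^K
with 0 ≤ b ≤ 1/p, and this function is stationary at b = 0. Collisions have probability O(1/p), so
the mean absolute increment is O(p^(-j-1)) (`meanBox_abs_levelIncr_le`).

Summed over the lattice points of yC, a d-periodic F with d ≤ y gives its mean times y^k vol(C), up
to O(y^(k-1) d mean|F|) (`exists_abs_sum_sub_le`). Terms with d > y are bounded trivially. Rankin's
trick with the weight d^(2/3) bounds both errors by y^(k-2/3) times an Euler product
(`abs_sum_prod_levelFactor_sub_le`). The averaged product is bounded because ∑ p^(-4/3) converges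
(`exists_sum_meanBox_le`); the pointwise one is O(y^ε) by a divisor bound (`exists_prod_sum_le`).
Nothing depends on the level or on the set of primes, so both limits can be taken, and
`exists_isBigO_rpow_add` turns an arbitrary ε into o(1). -/

namespace TwoSquares

/-! ### Local solubility -/

/-- By the two-squares theorem a prime congruent to 3 modulo 4 divides a nonzero sum of two squares
to an even power, and here that power is exactly v because p does not divide u. -/
theorem even_of_sq_add_sq_eq {p : ℕ} (hp : p.Prime) (h3 : p % 4 = 3) {a b u : ℤ} {v : ℕ}
    (hu : ¬ (p : ℤ) ∣ u) (h : a ^ 2 + b ^ 2 = (p : ℤ) ^ v * u) : Even v := by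
  have := Fact.mk hp
  have hu0 : u.natAbs ≠ 0 := by
    intro h0
    exact hu (by rw [Int.natAbs_eq_zero.1 h0]; exact dvd_zero _)
  have hn : p ^ v * u.natAbs = a.natAbs ^ 2 + b.natAbs ^ 2 := by
    have h1 : (p : ℤ) ^ v * |u| = a ^ 2 + b ^ 2 := by
      have : 0 ≤ (p : ℤ) ^ v * u := h ▸ by positivity
      rw [← abs_of_nonneg this, abs_mul, abs_of_nonneg (by positivity : (0 : ℤ) ≤ (p : ℤ) ^ v)] at h
      exact h.symm
    zify
    rw [sq_abs, sq_abs]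
    exact h1
  have hval : padicValNat p (p ^ v * u.natAbs) = v := by
    rw [padicValNat.mul (pow_ne_zero _ hp.ne_zero) hu0, padicValNat.prime_pow,
      padicValNat.eq_zero_of_not_dvd (fun hd => hu (Int.natCast_dvd.2 hd)), add_zero]
  rcases Nat.eq_zero_or_pos v with rfl | hv
  · exact Even.zero
  rw [← hval]
  refine Nat.eq_sq_add_sq_iff.1 ⟨_, _, hn⟩ p ?_ h3
  exact Nat.mem_primeFactors.2 ⟨hp, (dvd_pow_self p hv.ne').mul_right _,
    mul_ne_zero (pow_ne_zero _ hp.ne_zero) hu0⟩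

/-- Descent on v: if a² + b² is even then a and b have the same parity, and ((a+b)/2)² + ((a-b)/2)²
is half of it. -/
theorem emod_four_of_sq_add_sq_eq {v : ℕ} : ∀ {a b u : ℤ}, Odd u →
    a ^ 2 + b ^ 2 = 2 ^ v * u → u % 4 = 1 := by
  induction v with
  | zero =>
    rintro a b u ⟨w, rfl⟩ h
    rw [pow_zero, one_mul] at h
    rcases Int.even_or_odd' a with ⟨c, rfl | rfl⟩ <;> rcases Int.even_or_odd' b with ⟨d, rfl | rfl⟩ <;>
      ring_nf at h ⊢ <;> omega
  | succ v ih =>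
    intro a b u hu h
    have hpar : Even (a ^ 2 + b ^ 2) := by
      rw [h, pow_succ]
      exact ⟨2 ^ v * u, by ring⟩
    obtain ⟨c, hc⟩ : Even (a + b) := by
      rw [Int.even_add] at hpar ⊢
      simpa [Int.even_pow] using hpar
    refine ih (a := c) (b := c - b) hu ?_
    have ha : a = 2 * c - b := by linarith
    subst ha
    rw [pow_succ (2 : ℤ)] at h
    linarith

/-- Since v < m, a congruence modulo p^m preserves the exact power of p, so the parity obstruction
is visible modulo p^m. Conversely, a unit is a sum of two squares modulo p^m, and multiplying by the
square p^v keeps it one. -/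
theorem isSumTwoSqMod_pow_mul_iff {p : ℕ} (hp : p.Prime) (h3 : p % 4 = 3) {u : ℤ} {v m : ℕ}
    (hu : ¬ (p : ℤ) ∣ u) (hv : v < m) :
    IsSumTwoSqMod (p ^ m) ((p : ℤ) ^ v * u) ↔ Even v := by
  constructor
  · rintro ⟨_, ⟨a, b, rfl⟩, e⟩
    obtain ⟨c, hc⟩ := e.dvd
    obtain ⟨w, rfl⟩ := Nat.exists_eq_add_of_lt hv
    refine even_of_sq_add_sq_eq hp h3 (u := u + p * (p ^ w * c)) (a := a) (b := b) ?_ ?_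
    · rwa [Int.dvd_add_left (dvd_mul_right _ _)]
    · push_cast at hc
      rw [eq_add_of_sub_eq hc]
      ring
  · rintro ⟨w, rfl⟩
    have hp2 : p ≠ 2 := by rintro rfl; omega
    obtain ⟨_, ⟨a, b, rfl⟩, e⟩ := not_not.1 (mt (dvd_of_bad (α := m) hp hp2) hu)
    refine ⟨(p ^ w * a) ^ 2 + (p ^ w * b) ^ 2, ⟨_, _, rfl⟩, ?_⟩
    have := e.mul_left ((p : ℤ) ^ (w + w))
    convert this using 1
    ring

/-- Dirichlet's theorem gives a prime in the class of u, and a prime congruent to 1 modulo 4 is a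
sum of two squares. Working modulo 2^(m+2) ensures that the class remembers u modulo 4 even when m <
2. -/
theorem isSumTwoSqMod_two_of_emod_four {u : ℤ} (hu : u % 4 = 1) (m : ℕ) :
    IsSumTwoSqMod (2 ^ m) u := by
  have hN : (0 : ℤ) < (2 ^ (m + 2) : ℕ) := by positivity
  obtain ⟨x, hx⟩ : ∃ x : ℕ, (x : ℤ) = u % (2 ^ (m + 2) : ℕ) :=
    ⟨(u % (2 ^ (m + 2) : ℕ)).toNat, Int.toNat_of_nonneg (Int.emod_nonneg _ hN.ne')⟩
  have hxu : (x : ℤ) ≡ u [ZMOD ((2 ^ (m + 2) : ℕ) : ℤ)] := by rw [hx]; exact Int.mod_modEq _ _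
  have hd4 : (4 : ℤ) ∣ ((2 ^ (m + 2) : ℕ) : ℤ) := by
    push_cast; exact ⟨2 ^ m, by ring⟩
  have hx4 : x % 4 = 1 := by
    have := (hxu.of_dvd hd4)
    unfold Int.ModEq at this
    omega
  have hc : x.Coprime (2 ^ (m + 2)) := by
    refine Nat.Coprime.pow_right _ ?_
    rw [Nat.coprime_two_right, Nat.odd_iff]
    omega
  obtain ⟨q, -, hq, hqm⟩ := Nat.forall_exists_prime_gt_and_modEq 0 (by positivity) hc
  have hq4 : q % 4 = 1 := by
    have : q ≡ x [MOD 4] := hqm.of_dvd ⟨2 ^ m, by ring⟩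
    unfold Nat.ModEq at this
    omega
  have := Fact.mk hq
  obtain ⟨a, b, hab⟩ := Nat.Prime.sq_add_sq (p := q) (by omega)
  refine ⟨(q : ℤ), ⟨a, b, by exact_mod_cast hab.symm⟩, ?_⟩
  have h1 := hxu.symm.trans (Int.natCast_modEq_iff.2 hqm.symm)
  refine h1.of_dvd ?_
  push_cast
  exact ⟨4, by ring⟩

/-- The condition v + 2 ≤ m means that the class modulo 2^m determines u modulo 4. For the converse,
2(a² + b²) = (a+b)² + (a-b)² lets powers of 2 be inserted one at a time. -/
theorem isSumTwoSqMod_two_pow_mul_iff {u : ℤ} {v m : ℕ} (hu : Odd u) (hv : v + 2 ≤ m) :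
    IsSumTwoSqMod (2 ^ m) (2 ^ v * u) ↔ u % 4 = 1 := by
  constructor
  · rintro ⟨_, ⟨a, b, rfl⟩, e⟩
    obtain ⟨c, hc⟩ := e.dvd
    obtain ⟨w, rfl⟩ := Nat.exists_eq_add_of_le hv
    have h1 : (u + 4 * (2 ^ w * c)) % 4 = 1 := by
      refine emod_four_of_sq_add_sq_eq (v := v) (a := a) (b := b) ?_ ?_
      · exact hu.add_even ⟨2 * (2 ^ w * c), by ring⟩
      · push_cast at hc
        rw [eq_add_of_sub_eq hc]
        ring
    omega
  · intro h
    clear hv hu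
    induction v with
    | zero => simpa using isSumTwoSqMod_two_of_emod_four h m
    | succ v ih =>
      obtain ⟨_, ⟨a, b, rfl⟩, e⟩ := ih
      refine ⟨(a + b) ^ 2 + (a - b) ^ 2, ⟨_, _, rfl⟩, ?_⟩
      have := e.mul_left 2
      convert this using 1 <;> ring

/-- A modification of `IsSumTwoSqMod (p ^ j)` that depends on `j` only through `p ^ j ∣ 4 * n`. -/
def IsLocalSum (p j : ℕ) (n : ℤ) : Prop :=
  IsSumTwoSqMod (p ^ j) n ∧ (Odd j → ¬ (p : ℤ) ^ j ∣ n)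

theorem isLocalSum_congr {p j : ℕ} {m n : ℤ} (h : m ≡ n [ZMOD (p : ℤ) ^ j]) :
    IsLocalSum p j m ↔ IsLocalSum p j n := by
  have h' : m ≡ n [ZMOD ((p ^ j : ℕ) : ℤ)] := by exact_mod_cast h
  unfold IsLocalSum
  rw [isSumTwoSqMod_congr h', h.dvd_iff]

theorem isLocalSum_zero (p : ℕ) (n : ℤ) : IsLocalSum p 0 n :=
  ⟨⟨0, ⟨0, 0, by norm_num⟩, by simpa using Int.modEq_one⟩, by simp⟩

theorem isLocalSum_iff_of_not_dvd {p j : ℕ} {n : ℤ} (h : ¬ (p : ℤ) ^ j ∣ n) :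
    IsLocalSum p j n ↔ IsSumTwoSqMod (p ^ j) n := by
  simp [IsLocalSum, h]

theorem isLocalSum_of_dvd {p j : ℕ} {n : ℤ} (h : (p : ℤ) ^ j ∣ n) :
    IsLocalSum p j n ↔ Even j := by
  have : IsSumTwoSqMod (p ^ j) n :=
    ⟨0, ⟨0, 0, by norm_num⟩, by push_cast; exact Int.modEq_zero_iff_dvd.2 h⟩
  simp [IsLocalSum, h, this]

theorem exists_eq_pow_mul_of_not_dvd {p : ℕ} (hp : p.Prime) {m : ℕ} {n : ℤ}
    (h : ¬ (p : ℤ) ^ m ∣ n) : ∃ v < m, ∃ u : ℤ, ¬ (p : ℤ) ∣ u ∧ n = (p : ℤ) ^ v * u := by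
  have hn : n ≠ 0 := by rintro rfl; exact h (dvd_zero _)
  have hf : FiniteMultiplicity (p : ℤ) n :=
    Int.finiteMultiplicity_iff.2 ⟨by simpa using hp.one_lt.ne', hn⟩
  obtain ⟨u, hu, hd⟩ := hf.exists_eq_pow_mul_and_not_dvd
  refine ⟨_, ?_, u, hd, hu⟩
  by_contra hc
  exact h ((pow_dvd_pow _ (not_lt.1 hc)).trans ⟨u, hu⟩)

theorem LocalPrime.mod_four {p : ℕ} (hp : p.Prime) (h1 : ¬ p ≡ 1 [MOD 4]) (h2 : p ≠ 2) :
    p % 4 = 3 := by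
  have := hp.eq_two_or_odd
  unfold Nat.ModEq at h1
  omega

/-- This stability is the purpose of the clause on odd j in `IsLocalSum`. If p ≡ 3 mod 4 and p^j
divides n exactly, then n ≡ 0 is a sum of two squares modulo p^j, but modulo p^(j+1) only if j is
even; the clause anticipates this verdict. Levels j and j + 1 can then differ only where p^(j+1) ∣
n, a set of density p^(-j-1) rather than p^(-j). For p = 2 the verdict needs the odd part modulo 4,
which costs the factor 4. -/
theorem isLocalSum_succ_iff {p : ℕ} (hp : p.Prime) (h1 : ¬ p ≡ 1 [MOD 4]) {j : ℕ} {n : ℤ}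
    (h : ¬ (p : ℤ) ^ (j + 1) ∣ 4 * n) : IsLocalSum p (j + 1) n ↔ IsLocalSum p j n := by
  have hn : ¬ (p : ℤ) ^ (j + 1) ∣ n := fun hd => h (hd.mul_left _)
  obtain ⟨v, hv, u, hu, rfl⟩ := exists_eq_pow_mul_of_not_dvd hp hn
  rw [isLocalSum_iff_of_not_dvd hn]
  by_cases h2 : p = 2
  · subst h2
    have hu' : Odd u := by
      rw [← Int.not_even_iff_odd, even_iff_two_dvd]
      exact hu
    have hvj : v + 2 ≤ j := by
      by_contra hc
      refine h ((pow_dvd_pow _ (by omega : j + 1 ≤ v + 2)).trans ⟨u, ?_⟩)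
      push_cast
      ring
    have hn' : ¬ ((2 : ℕ) : ℤ) ^ j ∣ ((2 : ℕ) : ℤ) ^ v * u := by
      intro hd
      have := (pow_dvd_pow ((2 : ℕ) : ℤ) (by omega : v + 1 ≤ j)).trans hd
      rw [pow_succ, mul_dvd_mul_iff_left (by positivity)] at this
      exact hu this
    rw [isLocalSum_iff_of_not_dvd hn']
    push_cast
    rw [isSumTwoSqMod_two_pow_mul_iff hu' (by omega), isSumTwoSqMod_two_pow_mul_iff hu' hvj]
  · have h3 := LocalPrime.mod_four hp h1 h2
    have hp0 : (p : ℤ) ^ v ≠ 0 := pow_ne_zero _ (by exact_mod_cast hp.ne_zero)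
    rw [isSumTwoSqMod_pow_mul_iff hp h3 hu hv]
    rcases Nat.lt_succ_iff_lt_or_eq.1 hv with hlt | rfl
    · have hn' : ¬ (p : ℤ) ^ j ∣ (p : ℤ) ^ v * u := by
        intro hd
        have := (pow_dvd_pow (p : ℤ) (by omega : v + 1 ≤ j)).trans hd
        rw [pow_succ, mul_dvd_mul_iff_left hp0] at this
        exact hu this
      rw [isLocalSum_iff_of_not_dvd hn', isSumTwoSqMod_pow_mul_iff hp h3 hu hlt]
    · rw [isLocalSum_of_dvd (dvd_mul_right _ _)]

theorem dvd_of_not_isLocalSum {p j : ℕ} (hp : p.Prime) (hp2 : p ≠ 2) {n : ℤ}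
    (h : ¬ IsLocalSum p j n) : (p : ℤ) ∣ n := by
  rcases Nat.eq_zero_or_pos j with rfl | hj
  · exact absurd (isLocalSum_zero p n) h
  by_cases hd : (p : ℤ) ^ j ∣ n
  · exact (dvd_pow_self _ hj.ne').trans hd
  · rw [isLocalSum_iff_of_not_dvd hd] at h
    exact dvd_of_bad hp hp2 h

theorem isLocalSum_two_of_emod_four (j : ℕ) {n : ℤ} (h : n % 4 = 1) : IsLocalSum 2 j n := by
  refine ⟨isSumTwoSqMod_two_of_emod_four h j, fun hj hd => ?_⟩
  have := (dvd_pow_self ((2 : ℕ) : ℤ) (Nat.ne_of_gt hj.pos)).trans hd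
  push_cast at this
  omega

/-! ### Mean values of periodic functions -/

/-- The mean of `f` over `0 ≤ a < N`. -/
noncomputable def mean (N : ℕ) (f : ℤ → ℝ) : ℝ := (∑ a ∈ Finset.Ico (0 : ℤ) N, f a) / N

/-- The box `{0, …, N - 1} ^ k`. -/
noncomputable def box (k N : ℕ) : Finset (Fin k → ℤ) := Fintype.piFinset fun _ => Finset.Ico (0 : ℤ) N

/-- The mean of `F` over the box `{0, …, N - 1} ^ k`. -/
noncomputable def meanBox {k : ℕ} (N : ℕ) (F : (Fin k → ℤ) → ℝ) : ℝ :=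
  (∑ h ∈ box k N, F h) / (N : ℝ) ^ k

/-- `F` depends only on the coordinates modulo `N`. -/
def IsPeriodic {k : ℕ} (N : ℕ) (F : (Fin k → ℤ) → ℝ) : Prop :=
  ∀ h h' : Fin k → ℤ, (∀ i, h i ≡ h' i [ZMOD (N : ℤ)]) → F h = F h'

theorem mem_box {k N : ℕ} {h : Fin k → ℤ} : h ∈ box k N ↔ ∀ i, 0 ≤ h i ∧ h i < N := by
  simp [box]

theorem card_box (k N : ℕ) : (box k N).card = N ^ k := by
  simp [box]

theorem emod_mem_box {k N : ℕ} (hN : 0 < N) (h : Fin k → ℤ) : (fun i => h i % N) ∈ box k N :=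
  mem_box.2 fun _ => ⟨Int.emod_nonneg _ (by positivity), Int.emod_lt_of_pos _ (by positivity)⟩

theorem eq_of_mem_box_of_modEq {k N : ℕ} {h h' : Fin k → ℤ} (hh : h ∈ box k N)
    (hh' : h' ∈ box k N) (e : ∀ i, h i ≡ h' i [ZMOD (N : ℤ)]) : h = h' := by
  funext i
  have h1 := mem_box.1 hh i
  have h2 := mem_box.1 hh' i
  have := e i
  unfold Int.ModEq at this
  rwa [Int.emod_eq_of_lt h1.1 h1.2, Int.emod_eq_of_lt h2.1 h2.2] at this

theorem sum_Ico_shift {N : ℕ} (hN : 0 < N) {f : ℤ → ℝ}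
    (hf : ∀ a b : ℤ, a ≡ b [ZMOD (N : ℤ)] → f a = f b) (c : ℤ) :
    ∑ a ∈ Finset.Ico (0 : ℤ) N, f (a + c) = ∑ a ∈ Finset.Ico (0 : ℤ) N, f a := by
  have hN' : (0 : ℤ) < N := by positivity
  have key : ∀ c a : ℤ, a ∈ Finset.Ico (0 : ℤ) N → ((a + c) % N + (-c)) % N = a := by
    intro c a ha
    have ha := Finset.mem_Ico.1 ha
    rw [Int.emod_add_emod, add_neg_cancel_right, Int.emod_eq_of_lt ha.1 ha.2]
  refine Finset.sum_bij' (fun a _ => (a + c) % N) (fun a _ => (a + -c) % N) ?_ ?_ ?_ ?_ ?_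
  · exact fun a _ => Finset.mem_Ico.2 ⟨Int.emod_nonneg _ hN'.ne', Int.emod_lt_of_pos _ hN'⟩
  · exact fun a _ => Finset.mem_Ico.2 ⟨Int.emod_nonneg _ hN'.ne', Int.emod_lt_of_pos _ hN'⟩
  · exact fun a ha => key c a ha
  · intro a ha
    simpa using key (-c) a ha
  · exact fun a _ => hf _ _ (Int.mod_modEq _ _).symm

theorem sum_Ico_mul {m : ℕ} (hm : 0 < m) {f : ℤ → ℝ}
    (hf : ∀ a b : ℤ, a ≡ b [ZMOD (m : ℤ)] → f a = f b) (c : ℕ) :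
    ∑ a ∈ Finset.Ico (0 : ℤ) (m * c : ℕ), f a = c * ∑ a ∈ Finset.Ico (0 : ℤ) m, f a := by
  induction c with
  | zero => simp
  | succ c ih =>
    have h1 : Finset.Ico (0 : ℤ) (m * (c + 1) : ℕ) =
        Finset.Ico (0 : ℤ) (m * c : ℕ) ∪ Finset.Ico ((m * c : ℕ) : ℤ) (m * (c + 1) : ℕ) := by
      rw [Finset.Ico_union_Ico_eq_Ico (by positivity) (by push_cast; nlinarith)]
    have h2 : ∑ a ∈ Finset.Ico ((m * c : ℕ) : ℤ) (m * (c + 1) : ℕ), f a =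
        ∑ a ∈ Finset.Ico (0 : ℤ) m, f a := by
      rw [← sum_Ico_shift hm hf ((m * c : ℕ) : ℤ), ← Finset.sum_image (f := f)
        (g := fun a : ℤ => a + ((m * c : ℕ) : ℤ)) (fun a _ b _ hab => by simpa using hab),
        Finset.image_add_right_Ico]
      congr 2
      · ring
      · push_cast; ring
    rw [h1, Finset.sum_union (Finset.Ico_disjoint_Ico_consecutive _ _ _), ih, h2]
    push_cast
    ring

theorem mean_shift {N : ℕ} (hN : 0 < N) {f : ℤ → ℝ}
    (hf : ∀ a b : ℤ, a ≡ b [ZMOD (N : ℤ)] → f a = f b) (c : ℤ) :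
    mean N (fun a => f (a + c)) = mean N f := by
  rw [mean, mean, sum_Ico_shift hN hf]

theorem mean_eq_of_dvd {m N : ℕ} (hN : 0 < N) (hd : m ∣ N) {f : ℤ → ℝ}
    (hf : ∀ a b : ℤ, a ≡ b [ZMOD (m : ℤ)] → f a = f b) : mean N f = mean m f := by
  obtain ⟨c, rfl⟩ := hd
  have hm : 0 < m := Nat.pos_of_mul_pos_right hN
  have hc : 0 < c := Nat.pos_of_mul_pos_left hN
  rw [mean, mean, sum_Ico_mul hm hf]
  have : (0 : ℝ) < m := by positivity
  have : (0 : ℝ) < c := by positivity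
  push_cast
  field_simp

theorem mean_mono {N : ℕ} {f g : ℤ → ℝ} (h : ∀ a, f a ≤ g a) : mean N f ≤ mean N g :=
  div_le_div_of_nonneg_right (Finset.sum_le_sum fun a _ => h a) (by positivity)

theorem mean_const {N : ℕ} (hN : 0 < N) (c : ℝ) : mean N (fun _ => c) = c := by
  have : (0 : ℝ) < N := by positivity
  simp [mean]
  field_simp

theorem mean_sub (N : ℕ) (f g : ℤ → ℝ) : mean N (fun a => f a - g a) = mean N f - mean N g := by
  rw [mean, mean, mean, Finset.sum_sub_distrib, sub_div]

theorem mean_sum {ι : Type*} (s : Finset ι) (N : ℕ) (f : ι → ℤ → ℝ) :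
    mean N (fun a => ∑ i ∈ s, f i a) = ∑ i ∈ s, mean N (f i) := by
  simp only [mean]
  rw [Finset.sum_comm, Finset.sum_div]

theorem mean_mul_right (N : ℕ) (f : ℤ → ℝ) (c : ℝ) :
    mean N (fun a => f a * c) = mean N f * c := by
  simp only [mean, ← Finset.sum_mul]
  ring

theorem mean_nonneg {N : ℕ} {f : ℤ → ℝ} (h : ∀ a, 0 ≤ f a) : 0 ≤ mean N f :=
  div_nonneg (Finset.sum_nonneg fun a _ => h a) (by positivity)

theorem abs_mean_le (N : ℕ) (f : ℤ → ℝ) : |mean N f| ≤ mean N (fun a => |f a|) := by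
  rw [mean, mean, abs_div, Nat.abs_cast]
  exact div_le_div_of_nonneg_right (Finset.abs_sum_le_sum_abs _ _) (by positivity)

theorem meanBox_mono {k N : ℕ} {f g : (Fin k → ℤ) → ℝ} (h : ∀ a, f a ≤ g a) :
    meanBox N f ≤ meanBox N g :=
  div_le_div_of_nonneg_right (Finset.sum_le_sum fun a _ => h a) (by positivity)

theorem meanBox_const {k N : ℕ} (hN : 0 < N) (c : ℝ) :
    meanBox N (fun _ : Fin k → ℤ => c) = c := by
  have : (0 : ℝ) < (N : ℝ) ^ k := by positivity
  simp only [meanBox, Finset.sum_const, card_box, nsmul_eq_mul]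
  push_cast
  field_simp

theorem meanBox_add {k : ℕ} (N : ℕ) (f g : (Fin k → ℤ) → ℝ) :
    meanBox N (fun a => f a + g a) = meanBox N f + meanBox N g := by
  rw [meanBox, meanBox, meanBox, Finset.sum_add_distrib, add_div]

theorem meanBox_sub {k : ℕ} (N : ℕ) (f g : (Fin k → ℤ) → ℝ) :
    meanBox N (fun a => f a - g a) = meanBox N f - meanBox N g := by
  rw [meanBox, meanBox, meanBox, Finset.sum_sub_distrib, sub_div]

theorem meanBox_sum {ι : Type*} (s : Finset ι) {k : ℕ} (N : ℕ) (f : ι → (Fin k → ℤ) → ℝ) :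
    meanBox N (fun a => ∑ i ∈ s, f i a) = ∑ i ∈ s, meanBox N (f i) := by
  simp only [meanBox]
  rw [Finset.sum_comm, Finset.sum_div]

theorem meanBox_mul_left {k : ℕ} (N : ℕ) (f : (Fin k → ℤ) → ℝ) (c : ℝ) :
    meanBox N (fun a => c * f a) = c * meanBox N f := by
  simp only [meanBox, ← Finset.mul_sum]
  ring

theorem meanBox_div {k : ℕ} (N : ℕ) (f : (Fin k → ℤ) → ℝ) (c : ℝ) :
    meanBox N (fun a => f a / c) = meanBox N f / c := by
  simp only [meanBox, ← Finset.sum_div]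
  ring

theorem meanBox_nonneg {k N : ℕ} {f : (Fin k → ℤ) → ℝ} (h : ∀ a, 0 ≤ f a) : 0 ≤ meanBox N f :=
  div_nonneg (Finset.sum_nonneg fun a _ => h a) (by positivity)

theorem meanBox_prod {k : ℕ} (N : ℕ) (f : Fin k → ℤ → ℝ) :
    meanBox N (fun h => ∏ i, f i (h i)) = ∏ i, mean N (f i) := by
  simp only [meanBox, mean, box, Finset.prod_div_distrib, Finset.prod_const, Finset.card_univ,
    Fintype.card_fin]
  rw [Finset.prod_univ_sum]

/-- The Chinese remainder theorem for means. -/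
theorem meanBox_mul_of_coprime {k M N : ℕ} (hM : 0 < M) (hN : 0 < N) (hMN : M.Coprime N)
    {F G : (Fin k → ℤ) → ℝ} (hF : IsPeriodic M F) (hG : IsPeriodic N G) :
    meanBox (M * N) (fun h => F h * G h) = meanBox M F * meanBox N G := by
  have hMN0 : 0 < M * N := Nat.mul_pos hM hN
  have hinj : Set.InjOn (fun h : Fin k → ℤ => (fun i => h i % (M : ℤ), fun i => h i % (N : ℤ)))
      (box k (M * N)) := by
    intro h hh h' hh' e
    refine eq_of_mem_box_of_modEq hh hh' fun i => ?_
    have e1 : h i ≡ h' i [ZMOD (M : ℤ)] := congrFun (congrArg Prod.fst e) i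
    have e2 : h i ≡ h' i [ZMOD (N : ℤ)] := congrFun (congrArg Prod.snd e) i
    have := (Int.modEq_and_modEq_iff_modEq_mul (m := (M : ℤ)) (n := (N : ℤ)) (by simpa using hMN)).1
      ⟨e1, e2⟩
    exact_mod_cast this
  have himg : (box k (M * N)).image
      (fun h : Fin k → ℤ => (fun i => h i % (M : ℤ), fun i => h i % (N : ℤ))) =
      box k M ×ˢ box k N := by
    refine Finset.eq_of_subset_of_card_le ?_ ?_
    · refine Finset.image_subset_iff.2 fun h _ => Finset.mem_product.2 ?_
      exact ⟨emod_mem_box hM h, emod_mem_box hN h⟩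
    · rw [Finset.card_image_of_injOn hinj, Finset.card_product, card_box, card_box, card_box,
        mul_pow]
  have hsum : ∑ h ∈ box k (M * N), F h * G h = (∑ h ∈ box k M, F h) * ∑ h ∈ box k N, G h := by
    rw [Finset.sum_mul_sum, ← Finset.sum_product', ← himg, Finset.sum_image hinj]
    refine Finset.sum_congr rfl fun h _ => ?_
    exact congrArg₂ _ (hF _ _ fun i => (Int.mod_modEq _ _).symm)
      (hG _ _ fun i => (Int.mod_modEq _ _).symm)
  rw [meanBox, meanBox, meanBox, hsum, div_mul_div_comm]
  push_cast
  rw [mul_pow]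

theorem isPeriodic_prod {ι : Type*} (s : Finset ι) {k : ℕ} (N : ι → ℕ)
    (F : ι → (Fin k → ℤ) → ℝ) (hF : ∀ i ∈ s, IsPeriodic (N i) (F i)) :
    IsPeriodic (∏ i ∈ s, N i) (fun h => ∏ i ∈ s, F i h) := by
  intro h h' e
  refine Finset.prod_congr rfl fun i hi => hF i hi _ _ fun x => (e x).of_dvd ?_
  exact_mod_cast Finset.dvd_prod_of_mem N hi

theorem meanBox_prod_of_coprime {ι : Type*} (s : Finset ι) {k : ℕ} (N : ι → ℕ)
    (hN : ∀ i ∈ s, 0 < N i) (hc : ∀ i ∈ s, ∀ j ∈ s, i ≠ j → (N i).Coprime (N j))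
    (F : ι → (Fin k → ℤ) → ℝ) (hF : ∀ i ∈ s, IsPeriodic (N i) (F i)) :
    meanBox (∏ i ∈ s, N i) (fun h => ∏ i ∈ s, F i h) = ∏ i ∈ s, meanBox (N i) (F i) := by
  classical
  induction s using Finset.induction_on with
  | empty => simp [meanBox_const]
  | insert a s ha ih =>
    simp only [Finset.prod_insert ha]
    rw [meanBox_mul_of_coprime (hN a (Finset.mem_insert_self _ _))
      (Finset.prod_pos fun i hi => hN i (Finset.mem_insert_of_mem hi)) ?_
      (hF a (Finset.mem_insert_self _ _))
      (isPeriodic_prod s N F fun i hi => hF i (Finset.mem_insert_of_mem hi)),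
      ih (fun i hi => hN i (Finset.mem_insert_of_mem hi))
        (fun i hi j hj => hc i (Finset.mem_insert_of_mem hi) j (Finset.mem_insert_of_mem hj))
        (fun i hi => hF i (Finset.mem_insert_of_mem hi))]
    refine Nat.Coprime.prod_right fun i hi => hc a (Finset.mem_insert_self _ _) i
      (Finset.mem_insert_of_mem hi) ?_
    rintro rfl
    exact ha hi

/-! ### Local factors -/

/-- The factors are replaced one at a time; the others lie in [0, 1] and do not enlarge the change.
-/
theorem abs_prod_sub_prod_le {ι : Type*} (s : Finset ι) {f g : ι → ℝ} (hf : ∀ i, f i ∈ Set.Icc (0 : ℝ) 1)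
    (hg : ∀ i, g i ∈ Set.Icc (0 : ℝ) 1) :
    |∏ i ∈ s, f i - ∏ i ∈ s, g i| ≤ ∑ i ∈ s, |f i - g i| := by
  classical
  induction s using Finset.induction_on with
  | empty => simp
  | insert a s ha ih =>
    rw [Finset.prod_insert ha, Finset.prod_insert ha, Finset.sum_insert ha]
    have e : f a * ∏ i ∈ s, f i - g a * ∏ i ∈ s, g i =
        (f a - g a) * ∏ i ∈ s, f i + g a * (∏ i ∈ s, f i - ∏ i ∈ s, g i) := by ring
    have h1 : |∏ i ∈ s, f i| ≤ 1 := by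
      rw [abs_of_nonneg (Finset.prod_nonneg fun i _ => (hf i).1)]
      exact Finset.prod_le_one (fun i _ => (hf i).1) fun i _ => (hf i).2
    have h2 : |g a| ≤ 1 := by
      rw [abs_of_nonneg (hg a).1]
      exact (hg a).2
    rw [e]
    refine (abs_add_le _ _).trans (add_le_add ?_ ?_)
    · rw [abs_mul]
      exact mul_le_of_le_one_right (abs_nonneg _) h1
    · rw [abs_mul]
      exact (mul_le_of_le_one_left (abs_nonneg _) h2).trans ih

section LocalFactors

variable {ι : Type*} [Fintype ι]

open Classical in
/-- The indicator function of `IsLocalSum p j`. -/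
noncomputable def localInd (p j : ℕ) (n : ℤ) : ℝ := if IsLocalSum p j n then 1 else 0

/-- The density of `a` modulo `p ^ j` such that all the `a + H i` satisfy `IsLocalSum p j`. -/
noncomputable def tupleDensity (p j : ℕ) (H : ι → ℤ) : ℝ :=
  mean (p ^ j) (fun a => ∏ i, localInd p j (a + H i))

/-- The density of `IsLocalSum p j`. -/
noncomputable def levelDensity (p j : ℕ) : ℝ := mean (p ^ j) (localInd p j)

/-- The local factor at `p` to precision `p ^ j`. -/
noncomputable def levelFactor (p j : ℕ) (H : ι → ℤ) : ℝ :=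
  tupleDensity p j H / levelDensity p j ^ Fintype.card ι

/-- The increments of `levelFactor`. -/
noncomputable def levelIncr (p : ℕ) : ℕ → (ι → ℤ) → ℝ
  | 0, H => levelFactor p 0 H
  | j + 1, H => levelFactor p (j + 1) H - levelFactor p j H

open Classical in
/-- The product of the differences of distinct entries of `H`. -/
noncomputable def diffProd (H : ι → ℤ) : ℤ :=
  ∏ x ∈ (Finset.univ : Finset ι).offDiag, (H x.1 - H x.2)

theorem localInd_mem (p j : ℕ) (n : ℤ) : localInd p j n ∈ Set.Icc (0 : ℝ) 1 := by
  unfold localInd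
  split_ifs <;> simp

theorem localInd_congr {p j : ℕ} {m n : ℤ} (h : m ≡ n [ZMOD ((p ^ j : ℕ) : ℤ)]) :
    localInd p j m = localInd p j n := by
  unfold localInd
  rw [isLocalSum_congr (by exact_mod_cast h)]

theorem localInd_zero (p : ℕ) (n : ℤ) : localInd p 0 n = 1 := if_pos (isLocalSum_zero p n)

theorem levelDensity_zero (p : ℕ) : levelDensity p 0 = 1 := by
  have : localInd p 0 = fun _ => 1 := funext (localInd_zero p)
  rw [levelDensity, this, mean_const (by simp)]

theorem tupleDensity_zero (p : ℕ) (H : ι → ℤ) : tupleDensity p 0 H = 1 := by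
  simp only [tupleDensity, localInd_zero, Finset.prod_const_one]
  rw [mean_const (by simp)]

theorem levelFactor_zero (p : ℕ) (H : ι → ℤ) : levelFactor p 0 H = 1 := by
  simp [levelFactor, tupleDensity_zero, levelDensity_zero]

theorem sum_levelIncr (p J : ℕ) (H : ι → ℤ) :
    ∑ j ∈ Finset.range (J + 1), levelIncr p j H = levelFactor p J H := by
  induction J with
  | zero => simp [levelIncr]
  | succ J ih => rw [Finset.sum_range_succ, ih, levelIncr]; ring

theorem tupleDensity_congr {p j : ℕ} {H H' : ι → ℤ}
    (h : ∀ i, H i ≡ H' i [ZMOD ((p ^ j : ℕ) : ℤ)]) : tupleDensity p j H = tupleDensity p j H' := by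
  unfold tupleDensity
  congr 1
  funext a
  exact Finset.prod_congr rfl fun i _ => localInd_congr ((h i).add_left a)

theorem levelIncr_congr {p j : ℕ} {H H' : ι → ℤ}
    (h : ∀ i, H i ≡ H' i [ZMOD ((p ^ j : ℕ) : ℤ)]) : levelIncr p j H = levelIncr p j H' := by
  cases j with
  | zero => simp [levelIncr, levelFactor_zero]
  | succ j =>
    have h' : ∀ i, H i ≡ H' i [ZMOD ((p ^ j : ℕ) : ℤ)] := fun i =>
      (h i).of_dvd (by exact_mod_cast pow_dvd_pow p (Nat.le_succ j))
    simp only [levelIncr, levelFactor, tupleDensity_congr h, tupleDensity_congr h']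

theorem tupleDensity_eq_mean {p j m : ℕ} (hp : 0 < p) (hjm : j ≤ m) (H : ι → ℤ) :
    tupleDensity p j H = mean (p ^ m) (fun a => ∏ i, localInd p j (a + H i)) := by
  refine (mean_eq_of_dvd (by positivity) (pow_dvd_pow p hjm) fun a b h => ?_).symm
  exact Finset.prod_congr rfl fun i _ => localInd_congr (h.add_right _)

theorem levelDensity_eq_mean {p j m : ℕ} (hp : 0 < p) (hjm : j ≤ m) (c : ℤ) :
    levelDensity p j = mean (p ^ m) (fun a => localInd p j (a + c)) := by
  rw [mean_eq_of_dvd (by positivity) (pow_dvd_pow p hjm)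
    fun a b h => localInd_congr (h.add_right _), mean_shift (by positivity)
    fun a b h => localInd_congr h, levelDensity]

theorem levelDensity_mem {p : ℕ} (hp : 0 < p) (j : ℕ) : levelDensity p j ∈ Set.Icc (0 : ℝ) 1 := by
  refine ⟨mean_nonneg fun a => (localInd_mem p j a).1, ?_⟩
  rw [← mean_const (N := p ^ j) (by positivity) 1]
  exact mean_mono fun a => (localInd_mem p j a).2

theorem tupleDensity_mem {p : ℕ} (hp : 0 < p) (j : ℕ) (H : ι → ℤ) :
    tupleDensity p j H ∈ Set.Icc (0 : ℝ) 1 := by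
  refine ⟨mean_nonneg fun a => Finset.prod_nonneg fun i _ => (localInd_mem p j _).1, ?_⟩
  rw [← mean_const (N := p ^ j) (by positivity) 1]
  exact mean_mono fun a => Finset.prod_le_one (fun i _ => (localInd_mem p j _).1)
    fun i _ => (localInd_mem p j _).2

theorem mean_dvd {N : ℕ} (hN : 0 < N) (c : ℤ) :
    mean N (fun a => if (N : ℤ) ∣ a + c then 1 else 0) = 1 / N := by
  have hper : ∀ a b : ℤ, a ≡ b [ZMOD (N : ℤ)] →
      (if (N : ℤ) ∣ a then (1 : ℝ) else 0) = if (N : ℤ) ∣ b then 1 else 0 := by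
    intro a b h
    simp only [h.dvd_iff]
  rw [mean_shift hN hper, mean, Finset.sum_eq_single 0]
  · simp
  · intro b hb hb0
    have hb := Finset.mem_Ico.1 hb
    exact if_neg fun hd => hb0 (Int.eq_zero_of_dvd_of_nonneg_of_lt hb.1 hb.2 hd)
  · intro h
    exact absurd (Finset.mem_Ico.2 ⟨le_refl 0, by exact_mod_cast hN⟩) h

theorem mean_dvd_of_dvd {d N : ℕ} (hN : 0 < N) (hd : d ∣ N) (c : ℤ) :
    mean N (fun a => if (d : ℤ) ∣ a + c then 1 else 0) = 1 / d := by
  rw [← mean_dvd (Nat.pos_of_dvd_of_pos hd hN) c]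
  refine mean_eq_of_dvd hN hd fun a b h => ?_
  simp only [(h.add_right c).dvd_iff]

theorem mean_dvd_four_mul_le {N : ℕ} (hN : 0 < N) (c : ℤ) :
    mean N (fun a => if (N : ℤ) ∣ 4 * (a + c) then 1 else 0) ≤ 4 / N := by
  have hN' : (N : ℤ) ≠ 0 := by positivity
  have hper : ∀ a b : ℤ, a ≡ b [ZMOD (N : ℤ)] →
      (if (N : ℤ) ∣ 4 * a then (1 : ℝ) else 0) = if (N : ℤ) ∣ 4 * b then 1 else 0 := by
    intro a b h
    simp only [(h.mul_left 4).dvd_iff]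
  rw [mean_shift hN hper, mean]
  refine div_le_div_of_nonneg_right ?_ (by positivity)
  rw [Finset.sum_boole]
  have : ((Finset.Ico (0 : ℤ) N).filter fun a => (N : ℤ) ∣ 4 * a).card ≤
      (Finset.range 4).card := by
    -- For 0 ≤ a < N with N ∣ 4a, the quotient 4a/N is one of 0, 1, 2, 3 and determines a.
    refine Finset.card_le_card_of_injOn (fun a => (4 * a / N).toNat) ?_ ?_
    · intro a ha
      obtain ⟨ha, c, hc⟩ := Finset.mem_filter.1 (Finset.mem_coe.1 ha)
      have ha := Finset.mem_Ico.1 ha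
      simp only [hc, Int.mul_ediv_cancel_left _ hN', Finset.coe_range, Set.mem_Iio]
      have : c < 4 := by nlinarith
      omega
    · intro a ha b hb hab
      obtain ⟨ha, c, hc⟩ := Finset.mem_filter.1 (Finset.mem_coe.1 ha)
      obtain ⟨hb, d, hd⟩ := Finset.mem_filter.1 (Finset.mem_coe.1 hb)
      have ha := Finset.mem_Ico.1 ha
      have hb := Finset.mem_Ico.1 hb
      simp only [hc, hd, Int.mul_ediv_cancel_left _ hN'] at hab
      have h1 : 0 ≤ c := by nlinarith
      have h2 : 0 ≤ d := by nlinarith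
      have h3 : c = d := by omega
      subst h3
      omega
  rw [Finset.card_range] at this
  exact_mod_cast this

theorem abs_localInd_sub_le {p : ℕ} (hp : p.Prime) (h1 : ¬ p ≡ 1 [MOD 4]) (j : ℕ) (n : ℤ) :
    |localInd p (j + 1) n - localInd p j n| ≤
      if ((p ^ (j + 1) : ℕ) : ℤ) ∣ 4 * n then 1 else 0 := by
  split_ifs with h
  · have a1 := localInd_mem p (j + 1) n
    have a2 := localInd_mem p j n
    rw [abs_le]
    constructor <;> linarith [a1.1, a1.2, a2.1, a2.2]
  · have := isLocalSum_succ_iff hp h1 (j := j) (n := n) (by exact_mod_cast h)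
    by_cases h' : IsLocalSum p j n <;> simp [localInd, h', this.2, mt this.1]

theorem abs_tupleDensity_sub_le {p : ℕ} (hp : p.Prime) (h1 : ¬ p ≡ 1 [MOD 4]) (j : ℕ)
    (H : ι → ℤ) : |tupleDensity p (j + 1) H - tupleDensity p j H| ≤
      4 * Fintype.card ι / (p : ℝ) ^ (j + 1) := by
  classical
  rw [tupleDensity_eq_mean hp.pos (Nat.le_succ j) H, tupleDensity, ← mean_sub]
  refine (abs_mean_le _ _).trans ?_
  have hpos : 0 < p ^ (j + 1) := pow_pos hp.pos _
  calc _ ≤ mean (p ^ (j + 1)) (fun a => ∑ i : ι,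
        if ((p ^ (j + 1) : ℕ) : ℤ) ∣ 4 * (a + H i) then (1 : ℝ) else 0) := by
        refine mean_mono fun a => ?_
        refine (abs_prod_sub_prod_le _ (fun i => localInd_mem _ _ _)
          fun i => localInd_mem _ _ _).trans ?_
        exact Finset.sum_le_sum fun i _ => abs_localInd_sub_le hp h1 j _
    _ ≤ ∑ i : ι, 4 / ((p ^ (j + 1) : ℕ) : ℝ) := by
        rw [mean_sum]
        exact Finset.sum_le_sum fun i _ => mean_dvd_four_mul_le hpos (H i)
    _ = _ := by
        rw [Finset.sum_const, Finset.card_univ, nsmul_eq_mul]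
        push_cast
        ring

theorem levelDensity_eq_tupleDensity (p j : ℕ) :
    levelDensity p j = tupleDensity p j (fun _ : Unit => 0) := by
  simp only [levelDensity, tupleDensity, Finset.univ_unique, Finset.prod_singleton, add_zero]

theorem abs_levelDensity_sub_le {p : ℕ} (hp : p.Prime) (h1 : ¬ p ≡ 1 [MOD 4]) (j : ℕ) :
    |levelDensity p (j + 1) - levelDensity p j| ≤ 4 / (p : ℝ) ^ (j + 1) := by
  simpa [levelDensity_eq_tupleDensity] using
    abs_tupleDensity_sub_le hp h1 j (fun _ : Unit => (0 : ℤ))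

theorem one_sub_levelDensity_le {p : ℕ} (hp : p.Prime) (h2 : p ≠ 2) (j : ℕ) :
    1 - levelDensity p j ≤ 1 / p := by
  classical
  rcases Nat.eq_zero_or_pos j with rfl | hj
  · rw [levelDensity_zero, sub_self]
    positivity
  have hpos : 0 < p ^ j := pow_pos hp.pos _
  have e := mean_sub (p ^ j) (fun _ => 1) (localInd p j)
  rw [mean_const hpos] at e
  rw [levelDensity, ← e, ← mean_dvd_of_dvd hpos (dvd_pow_self p hj.ne') 0]
  refine mean_mono fun a => ?_
  unfold localInd
  by_cases h : IsLocalSum p j a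
  · simp only [h, if_true, sub_self]
    split_ifs <;> norm_num
  · have := dvd_of_not_isLocalSum hp h2 h
    simp [h, this]

/-- For p = 2 the class 1 mod 4 alone has density 1/4; for odd p the density is at least 1 - 1/p.
The uniform bound is what makes division by the densities harmless. -/
theorem quarter_le_levelDensity {p : ℕ} (hp : p.Prime) (j : ℕ) : 1 / 4 ≤ levelDensity p j := by
  classical
  by_cases h2 : p = 2
  · subst h2
    have h := mean_dvd_of_dvd (d := 4) (N := 2 ^ (j + 2)) (by positivity) ⟨2 ^ j, by ring⟩ (-1)
    rw [levelDensity_eq_mean hp.pos (Nat.le_add_right j 2) 0]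
    refine le_trans (by rw [h]; norm_num) (mean_mono fun a => ?_)
    split_ifs with hd
    · have : IsLocalSum 2 j a := isLocalSum_two_of_emod_four j (by push_cast at hd; omega)
      simp [localInd, this]
    · exact (localInd_mem _ _ _).1
  · have h3 : (3 : ℝ) ≤ p := by
      have := hp.two_le
      exact_mod_cast (by omega : 3 ≤ p)
    have := one_sub_levelDensity_le hp h2 j
    have : (1 : ℝ) / p ≤ 1 / 3 := one_div_le_one_div_of_le (by norm_num) h3
    linarith

/-- If the entries of `H` are distinct modulo `p`, the local densities are explicit. -/
theorem tupleDensity_eq_of_not_dvd {p : ℕ} (hp : p.Prime) (h2 : p ≠ 2) (j : ℕ) {H : ι → ℤ}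
    (hH : ¬ (p : ℤ) ∣ diffProd H) :
    tupleDensity p j H = 1 - Fintype.card ι * (1 - levelDensity p j) := by
  classical
  have hpos : 0 < p ^ j := pow_pos hp.pos _
  -- Two conditions failing at once would force p to divide a difference of two entries. So at most
  -- one factor vanishes, and the product is linear in the failures.
  have key : ∀ a : ℤ, ∏ i, localInd p j (a + H i) = 1 - ∑ i, (1 - localInd p j (a + H i)) := by
    intro a
    by_cases hall : ∀ i, IsLocalSum p j (a + H i)
    · simp [localInd, hall]
    · obtain ⟨i, hi⟩ := not_forall.1 hall
      have hother : ∀ i' ≠ i, IsLocalSum p j (a + H i') := by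
        intro i' hne
        by_contra hi'
        refine hH ((Dvd.dvd.trans ?_ (Finset.dvd_prod_of_mem
          (fun x : ι × ι => H x.1 - H x.2) (show (i', i) ∈ _ from
            Finset.mem_offDiag.2 ⟨Finset.mem_univ i', Finset.mem_univ i, hne⟩))))
        have := dvd_sub (dvd_of_not_isLocalSum hp h2 hi') (dvd_of_not_isLocalSum hp h2 hi)
        simpa using this
      rw [Finset.prod_eq_zero (Finset.mem_univ i) (by simp [localInd, hi]),
        Finset.sum_eq_single i (fun i' _ hne => by simp [localInd, hother i' hne]) (by simp)]
      simp [localInd, hi]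
  rw [tupleDensity, funext key, mean_sub, mean_const hpos, mean_sum]
  congr 1
  have : ∀ i : ι, mean (p ^ j) (fun a => 1 - localInd p j (a + H i)) = 1 - levelDensity p j := by
    intro i
    rw [mean_sub, mean_const hpos, ← levelDensity_eq_mean hp.pos le_rfl]
  simp [this, mul_sub]

end LocalFactors

/-! ### Size of the increments -/

section LocalFactors

variable {ι : Type*} [Fintype ι]

theorem abs_pow_sub_pow_le {u u' : ℝ} (hu : u ∈ Set.Icc (0 : ℝ) 1) (hu' : u' ∈ Set.Icc (0 : ℝ) 1)
    (K : ℕ) : |u ^ K - u' ^ K| ≤ K * |u - u'| := by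
  have := abs_prod_sub_prod_le (Finset.univ : Finset (Fin K)) (f := fun _ => u) (g := fun _ => u')
    (fun _ => hu) fun _ => hu'
  simpa using this

/-- The quotient is Lipschitz in numerator and denominator; 16^K bounds 1/(u^K u'^K), as u and u'
are at least 1/4. -/
theorem abs_div_pow_sub_le {x x' u u' : ℝ} (hx' : x' ∈ Set.Icc (0 : ℝ) 1)
    (hu : u ∈ Set.Icc (1 / 4 : ℝ) 1) (hu' : u' ∈ Set.Icc (1 / 4 : ℝ) 1) (K : ℕ) :
    |x / u ^ K - x' / u' ^ K| ≤ 16 ^ K * (|x - x'| + K * |u - u'|) := by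
  have h0 : (0 : ℝ) < u := by linarith [hu.1]
  have h0' : (0 : ℝ) < u' := by linarith [hu'.1]
  have hK : 0 < u ^ K * u' ^ K := by positivity
  have e : x / u ^ K - x' / u' ^ K =
      ((x - x') * u' ^ K - x' * (u ^ K - u' ^ K)) / (u ^ K * u' ^ K) := by
    field_simp
    ring
  have h1 : |(x - x') * u' ^ K - x' * (u ^ K - u' ^ K)| ≤ |x - x'| + K * |u - u'| := by
    refine (abs_sub _ _).trans (add_le_add ?_ ?_)
    · rw [abs_mul, abs_of_pos (pow_pos h0' K)]
      exact mul_le_of_le_one_right (abs_nonneg _) (pow_le_one₀ h0'.le hu'.2)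
    · rw [abs_mul, abs_of_nonneg hx'.1]
      exact (mul_le_of_le_one_left (abs_nonneg _) hx'.2).trans
        (abs_pow_sub_pow_le ⟨h0.le, hu.2⟩ ⟨h0'.le, hu'.2⟩ K)
  have h2 : 1 ≤ 16 ^ K * (u ^ K * u' ^ K) := by
    rw [← mul_pow, ← mul_pow]
    refine one_le_pow₀ ?_
    nlinarith [hu.1, hu'.1]
  rw [e, abs_div, abs_of_pos hK, div_le_iff₀ hK]
  calc _ ≤ 1 * (|x - x'| + K * |u - u'|) := by rw [one_mul]; exact h1
    _ ≤ (16 ^ K * (u ^ K * u' ^ K)) * (|x - x'| + K * |u - u'|) :=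
      mul_le_mul_of_nonneg_right h2 (by positivity)
    _ = _ := by ring

/-- The derivative of (1 - Kb)/(1 - b)^K is -K(K-1)b/(1 - b)^(K+1), which vanishes at b = 0 and is
O(m) on [0, m]. With m = 1/p, this extra factor makes the later Euler products converge. -/
theorem abs_factor_sub_le (K : ℕ) {m b b' : ℝ} (hm : m ≤ 1 / 2) (hb : b ∈ Set.Icc 0 m)
    (hb' : b' ∈ Set.Icc 0 m) :
    |(1 - K * b) / (1 - b) ^ K - (1 - K * b') / (1 - b') ^ K| ≤
      (K : ℝ) ^ 2 * 2 ^ (K + 1) * m * |b - b'| := by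
  cases K with
  | zero => simp
  | succ n =>
    have hder : ∀ x ∈ Set.Icc (0 : ℝ) m, HasDerivWithinAt
        (fun x : ℝ => (1 - (n + 1 : ℕ) * x) / (1 - x) ^ (n + 1))
        (-((n + 1) * n * x) / (1 - x) ^ (n + 2)) (Set.Icc 0 m) x := by
      intro x hx
      have hx1 : 1 - x ≠ 0 := by linarith [hx.2]
      have h1 : HasDerivAt (fun x : ℝ => 1 - ((n + 1 : ℕ) : ℝ) * x) (-((n + 1 : ℕ) : ℝ)) x := by
        simpa using ((hasDerivAt_id x).const_mul ((n + 1 : ℕ) : ℝ)).const_sub 1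
      have h2 : HasDerivAt (fun x : ℝ => (1 - x) ^ (n + 1))
          (((n + 1 : ℕ) : ℝ) * (1 - x) ^ n * (-1)) x := by
        simpa using ((hasDerivAt_id x).const_sub 1).fun_pow (n + 1)
      have h3 := (h1.fun_div h2 (pow_ne_zero _ hx1)).hasDerivWithinAt (s := Set.Icc 0 m)
      refine h3.congr_deriv ?_
      push_cast
      field_simp
      ring
    have hbd : ∀ x ∈ Set.Icc (0 : ℝ) m,
        ‖-((n + 1) * n * x) / (1 - x) ^ (n + 2)‖ ≤ ((n + 1 : ℕ) : ℝ) ^ 2 * 2 ^ (n + 2) * m := by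
      intro x hx
      have hx0 := hx.1
      have hx1 : 1 / 2 ≤ 1 - x := by linarith [hx.2]
      have hpos : 0 < (1 - x) ^ (n + 2) := by positivity
      have h4 : 1 ≤ 2 ^ (n + 2) * (1 - x) ^ (n + 2) := by
        rw [← mul_pow]
        exact one_le_pow₀ (by linarith)
      rw [Real.norm_eq_abs, abs_div, abs_neg, abs_of_nonneg (by positivity), abs_of_pos hpos,
        div_le_iff₀ hpos]
      push_cast
      have h5 : ((n : ℝ) + 1) * n * x ≤ ((n : ℝ) + 1) ^ 2 * m := by
        rw [pow_two]
        exact mul_le_mul (by nlinarith [(Nat.cast_nonneg n : (0 : ℝ) ≤ n)]) hx.2 hx0 (by positivity)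
      have h6 : 0 ≤ ((n : ℝ) + 1) ^ 2 * m := mul_nonneg (by positivity) (hx0.trans hx.2)
      nlinarith
    have := (convex_Icc (0 : ℝ) m).norm_image_sub_le_of_norm_hasDerivWithin_le hder hbd hb' hb
    simpa [Real.norm_eq_abs] using this

/-- A constant depending only on the number of points. -/
noncomputable def incrConst (K : ℕ) : ℝ := 16 * (K : ℝ) ^ 2 * 16 ^ K

theorem incrConst_nonneg (K : ℕ) : 0 ≤ incrConst K := by unfold incrConst; positivity

open Classical in
/-- The indicator of the event that two entries of `H` agree modulo `p`. -/
noncomputable def collision (p : ℕ) (H : ι → ℤ) : ℝ := if (p : ℤ) ∣ diffProd H then 1 else 0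

theorem collision_nonneg (p : ℕ) (H : ι → ℤ) : 0 ≤ collision p H := by
  unfold collision; split_ifs <;> norm_num

/-- The Lipschitz bound always gives O(p^(-j-1)). When the entries are distinct modulo an odd p, the
explicit density and `abs_factor_sub_le` save a further 1/p. -/
theorem abs_levelIncr_le {p : ℕ} (hp : p.Prime) (h1 : ¬ p ≡ 1 [MOD 4]) (j : ℕ) (H : ι → ℤ) :
    |levelIncr p (j + 1) H| ≤
      incrConst (Fintype.card ι) / (p : ℝ) ^ (j + 1) * (collision p H + 1 / p) := by
  set K := Fintype.card ι with hKdef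
  have hp0 : (0 : ℝ) < p := by exact_mod_cast hp.pos
  have hP : (0 : ℝ) < (p : ℝ) ^ (j + 1) := by positivity
  have hδ := fun j => (⟨quarter_le_levelDensity hp j, (levelDensity_mem hp.pos j).2⟩ :
    levelDensity p j ∈ Set.Icc (1 / 4 : ℝ) 1)
  have hKK : (K : ℝ) ≤ (K : ℝ) ^ 2 := by exact_mod_cast Nat.le_self_pow two_ne_zero K
  have gen : |levelIncr p (j + 1) H| ≤ 8 * (K : ℝ) ^ 2 * 16 ^ K / (p : ℝ) ^ (j + 1) := by
    refine (abs_div_pow_sub_le (tupleDensity_mem hp.pos j H) (hδ _) (hδ _) K).trans ?_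
    calc _ ≤ 16 ^ K * (4 * K / (p : ℝ) ^ (j + 1) + K * (4 / (p : ℝ) ^ (j + 1))) := by
          gcongr
          · exact abs_tupleDensity_sub_le hp h1 j H
          · exact abs_levelDensity_sub_le hp h1 j
      _ = 8 * K * 16 ^ K / (p : ℝ) ^ (j + 1) := by ring
      _ ≤ _ := by gcongr
  by_cases hd : (p : ℤ) ∣ diffProd H
  · refine gen.trans ?_
    rw [collision, if_pos hd, incrConst]
    calc _ ≤ 16 * (K : ℝ) ^ 2 * 16 ^ K / (p : ℝ) ^ (j + 1) * 1 := by
          rw [mul_one]; gcongr; norm_num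
      _ ≤ _ := by
          refine mul_le_mul_of_nonneg_left ?_ (by positivity)
          linarith [one_div_pos.2 hp0]
  · rw [collision, if_neg hd, zero_add, incrConst]
    by_cases h2 : p = 2
    -- For p = 2 no saving is needed: the 16 in `incrConst` is twice the 8 of the general bound and
    -- absorbs 1/p = 1/2.
    · refine gen.trans (le_of_eq ?_)
      subst h2
      push_cast
      ring
    · have hb : ∀ j, 1 - levelDensity p j ∈ Set.Icc (0 : ℝ) (1 / p) := fun j =>
        ⟨by linarith [(hδ j).2], one_sub_levelDensity_le hp h2 j⟩
      have hm : (1 : ℝ) / p ≤ 1 / 2 :=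
        one_div_le_one_div_of_le (by norm_num) (by exact_mod_cast hp.two_le)
      have := abs_factor_sub_le K hm (hb (j + 1)) (hb j)
      rw [sub_sub_cancel, sub_sub_cancel] at this
      simp only [levelIncr, levelFactor]
      rw [tupleDensity_eq_of_not_dvd hp h2 _ hd, tupleDensity_eq_of_not_dvd hp h2 _ hd]
      refine this.trans ?_
      rw [sub_sub_sub_cancel_left, abs_sub_comm]
      calc _ ≤ (K : ℝ) ^ 2 * 2 ^ (K + 1) * (1 / p) * (4 / (p : ℝ) ^ (j + 1)) := by
            gcongr
            exact abs_levelDensity_sub_le hp h1 j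
        _ = 8 * (K : ℝ) ^ 2 * 2 ^ K / (p : ℝ) ^ (j + 1) * (1 / p) := by rw [pow_succ]; ring
        _ ≤ _ := by gcongr <;> norm_num

/-! ### Limits of local factors -/

open Classical in
theorem densityMod_eq_mean (H : Finset ℤ) (p j : ℕ) (T : ι → ℤ) (hT : Finset.univ.image T = H) :
    densityMod H p j = mean (p ^ j)
      (fun a => ∏ i, if IsSumTwoSqMod (p ^ j) (a + T i) then (1 : ℝ) else 0) := by
  have h1 : ∀ a : ℤ, (∏ i, if IsSumTwoSqMod (p ^ j) (a + T i) then (1 : ℝ) else 0) =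
      if ∀ h ∈ H, IsSumTwoSqMod (p ^ j) (a + h) then 1 else 0 := by
    intro a
    rw [Finset.prod_ite_zero]
    simp [← hT]
  have h2 : Finset.Ico (0 : ℤ) (p ^ j : ℕ) = (Finset.range (p ^ j)).image (fun a : ℕ => (a : ℤ)) := by
    ext a
    simp only [Finset.mem_Ico, Finset.mem_image, Finset.mem_range]
    constructor
    · rintro ⟨h0, h1⟩
      exact ⟨a.toNat, by omega, by omega⟩
    · rintro ⟨b, hb, rfl⟩
      exact ⟨by positivity, by exact_mod_cast hb⟩
  rw [densityMod, mean, h2, Finset.sum_image (fun a _ b _ hab => by exact_mod_cast hab)]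
  simp only [h1]
  rw [Finset.sum_boole]
  push_cast
  rfl

/-- The modified and the true conditions disagree only where p^j divides some a + T i, which has
density p^(-j) for each i. Hence both densities have the same limit. -/
theorem abs_densityMod_sub_le (H : Finset ℤ) {p : ℕ} (hp : 0 < p) (j : ℕ) (T : ι → ℤ)
    (hT : Finset.univ.image T = H) :
    |densityMod H p j - tupleDensity p j T| ≤ Fintype.card ι / (p : ℝ) ^ j := by
  classical
  have hpos : 0 < p ^ j := pow_pos hp _
  rw [densityMod_eq_mean H p j T hT, tupleDensity, ← mean_sub]
  refine (abs_mean_le _ _).trans ?_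
  calc _ ≤ mean (p ^ j) (fun a => ∑ i : ι,
        if ((p ^ j : ℕ) : ℤ) ∣ a + T i then (1 : ℝ) else 0) := by
        refine mean_mono fun a => ?_
        refine (abs_prod_sub_prod_le _ (fun i => ?_) fun i => localInd_mem _ _ _).trans ?_
        · split_ifs <;> simp
        · refine Finset.sum_le_sum fun i _ => ?_
          split_ifs with h1 h2 h2
          · have a2 := localInd_mem p j (a + T i)
            rw [abs_le]
            constructor <;> linarith [a2.1, a2.2]
          · have := (isLocalSum_iff_of_not_dvd (by exact_mod_cast h2)).2 h1
            simp [localInd, this]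
          · have a2 := localInd_mem p j (a + T i)
            rw [abs_le]
            constructor <;> linarith [a2.1, a2.2]
          · have := (not_congr (isLocalSum_iff_of_not_dvd (by exact_mod_cast h2))).2 h1
            simp [localInd, this]
    _ = ∑ i : ι, 1 / ((p ^ j : ℕ) : ℝ) := by
        rw [mean_sum]
        exact Finset.sum_congr rfl fun i _ => mean_dvd hpos (T i)
    _ = _ := by
        rw [Finset.sum_const, Finset.card_univ, nsmul_eq_mul]
        push_cast
        ring

theorem tendsto_tupleDensity (H : Finset ℤ) {p : ℕ} (hp : p.Prime) (T : ι → ℤ)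
    (hT : Finset.univ.image T = H) :
    Tendsto (fun j => tupleDensity p j T) atTop (𝓝 (localDensity H p)) := by
  have hp1 : (1 : ℝ) < p := by exact_mod_cast hp.one_lt
  have h0 : Tendsto (fun j : ℕ => (Fintype.card ι : ℝ) / (p : ℝ) ^ j) atTop (𝓝 0) :=
    tendsto_const_nhds.div_atTop (tendsto_pow_atTop_atTop_of_one_lt hp1)
  have h1 : Tendsto (fun j => densityMod H p j - tupleDensity p j T) atTop (𝓝 0) :=
    squeeze_zero_norm (fun j => abs_densityMod_sub_le H hp.pos j T hT) h0
  simpa using (tendsto_densityMod H hp.pos).sub h1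

theorem tendsto_levelFactor (H : Finset ℤ) {p : ℕ} (hp : p.Prime) (T : ι → ℤ)
    (hT : Finset.univ.image T = H) (hinj : Function.Injective T) :
    Tendsto (fun j => levelFactor p j T) atTop
      (𝓝 (localDensity H p / localDensity {0} p ^ H.card)) := by
  have hcard : H.card = Fintype.card ι := by
    rw [← hT, Finset.card_image_of_injective _ hinj, Finset.card_univ]
  have h1 : Tendsto (fun j => levelDensity p j) atTop (𝓝 (localDensity {0} p)) := by
    simp only [levelDensity_eq_tupleDensity]
    exact tendsto_tupleDensity {0} hp _ (by simp)
  have h2 : 1 / 4 ≤ localDensity {0} p := ge_of_tendsto' h1 fun j => quarter_le_levelDensity hp j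
  rw [hcard]
  exact (tendsto_tupleDensity H hp T hT).div (h1.pow _) (pow_ne_zero _ (by linarith))

end LocalFactors

/-! ### Means of local factors -/

section Means

variable {k : ℕ} (o : Finset ℤ)

/-- The tuple consisting of the elements of `o` and the entries of `h`. -/
def joinTuple (h : Fin k → ℤ) : o ⊕ Fin k → ℤ := Sum.elim (fun x => (x : ℤ)) h

theorem joinTuple_congr {N : ℤ} {h h' : Fin k → ℤ} (e : ∀ i, h i ≡ h' i [ZMOD N]) (x : o ⊕ Fin k) :
    joinTuple o h x ≡ joinTuple o h' x [ZMOD N] := by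
  cases x with
  | inl x => exact Int.ModEq.refl _
  | inr i => exact e i

variable {o}

/-- After exchanging the two averages, the entries a + h_i are independent and uniform for fixed a,
which gives the k-th power of the density. What remains is the mean over a of the factors from `o`;
having at most one of them makes this mean again a power of the density. A common modulus p^m serves
two consecutive levels at once. -/
theorem meanBox_tupleDensity (ho : o = ∅ ∨ o = {0}) {p j m : ℕ} (hp : 0 < p) (hjm : j ≤ m) :
    meanBox (k := k) (p ^ m) (fun h => tupleDensity p j (joinTuple o h)) =
      levelDensity p j ^ Fintype.card (o ⊕ Fin k) := by
  have hpos : 0 < p ^ m := pow_pos hp _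
  have h1 : ∀ h : Fin k → ℤ, tupleDensity p j (joinTuple o h) = mean (p ^ m)
      (fun a => (∏ x : o, localInd p j (a + x)) * ∏ i, localInd p j (a + h i)) := by
    intro h
    rw [tupleDensity_eq_mean hp hjm]
    simp only [Fintype.prod_sum_type, joinTuple, Sum.elim_inl, Sum.elim_inr]
  have h2 : ∀ a : ℤ, meanBox (k := k) (p ^ m) (fun h => ∏ i, localInd p j (a + h i)) =
      levelDensity p j ^ k := by
    intro a
    rw [meanBox_prod (p ^ m) (fun _ n => localInd p j (a + n))]
    simp only [add_comm a]
    simp [← levelDensity_eq_mean hp hjm]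
  have h3 : meanBox (k := k) (p ^ m) (fun h => mean (p ^ m)
      (fun a => (∏ x : o, localInd p j (a + x)) * ∏ i, localInd p j (a + h i))) =
      mean (p ^ m) (fun a => (∏ x : o, localInd p j (a + x)) *
        meanBox (k := k) (p ^ m) (fun h => ∏ i, localInd p j (a + h i))) := by
    simp only [mean]
    rw [meanBox_div, meanBox_sum]
    simp only [meanBox_mul_left]
  simp only [h1]
  rw [h3]
  simp only [h2]
  rw [mean_mul_right, Fintype.card_sum, Fintype.card_coe, Fintype.card_fin, pow_add]
  congr 1
  rcases ho with rfl | rfl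
  · simp [mean_const hpos]
  · simp only [Finset.univ_unique, Finset.prod_singleton, Finset.card_singleton, pow_one]
    exact (levelDensity_eq_mean hp hjm _).symm

theorem meanBox_levelIncr (ho : o = ∅ ∨ o = {0}) {p : ℕ} (hp : p.Prime) (j : ℕ) :
    meanBox (k := k) (p ^ (j + 1)) (fun h => levelIncr p (j + 1) (joinTuple o h)) = 0 := by
  have h0 : ∀ j, levelDensity p j ^ Fintype.card (o ⊕ Fin k) ≠ 0 := fun j =>
    pow_ne_zero _ (by linarith [quarter_le_levelDensity hp j])
  simp only [levelIncr, levelFactor]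
  rw [meanBox_sub, meanBox_div, meanBox_div, meanBox_tupleDensity ho hp.pos le_rfl,
    meanBox_tupleDensity ho hp.pos (Nat.le_succ j), div_self (h0 _), div_self (h0 _), sub_self]

/-- Resampling one coordinate does not change the mean: exchanging h i with t is an involution of
the box times the interval. -/
theorem meanBox_eq_mean_update {N : ℕ} (hN : 0 < N) (i : Fin k) (F : (Fin k → ℤ) → ℝ) :
    meanBox N F = meanBox N (fun h => mean N (fun t => F (Function.update h i t))) := by
  have hN' : (0 : ℝ) < N := by positivity
  have key : ∑ h ∈ box k N, ∑ t ∈ Finset.Ico (0 : ℤ) N, F (Function.update h i t) =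
      N * ∑ h ∈ box k N, F h := by
    have : ∑ h ∈ box k N, ∑ t ∈ Finset.Ico (0 : ℤ) N, F h = N * ∑ h ∈ box k N, F h := by
      simp [Finset.mul_sum]
    rw [← this, ← Finset.sum_product', ← Finset.sum_product']
    have hmem : ∀ x ∈ box k N ×ˢ Finset.Ico (0 : ℤ) N,
        (Function.update x.1 i x.2, x.1 i) ∈ box k N ×ˢ Finset.Ico (0 : ℤ) N := by
      rintro ⟨h, t⟩ hx
      obtain ⟨h1, h2⟩ := Finset.mem_product.1 hx
      have h1 := mem_box.1 h1
      refine Finset.mem_product.2 ⟨mem_box.2 fun i' => ?_, Finset.mem_Ico.2 (h1 i)⟩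
      by_cases e : i' = i
      · subst e
        simpa using h2
      · simpa [Function.update_of_ne e] using h1 i'
    refine Finset.sum_bij' (fun x _ => (Function.update x.1 i x.2, x.1 i))
      (fun x _ => (Function.update x.1 i x.2, x.1 i)) hmem hmem ?_ ?_ ?_
    · rintro ⟨h, t⟩ _
      simp
    · rintro ⟨h, t⟩ _
      simp
    · rintro ⟨h, t⟩ _
      rfl
  simp only [mean]
  rw [meanBox_div, meanBox, meanBox, key]
  field_simp

theorem meanBox_dvd_sub {p N : ℕ} (hN : 0 < N) (hd : p ∣ N) (i : Fin k)
    {c : (Fin k → ℤ) → ℤ} (hc : ∀ h t, c (Function.update h i t) = c h) :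
    meanBox N (fun h => if (p : ℤ) ∣ h i - c h then (1 : ℝ) else 0) = 1 / p := by
  rw [meanBox_eq_mean_update hN i]
  simp only [Function.update_self, hc, sub_eq_add_neg, mean_dvd_of_dvd hN hd]
  rw [meanBox_const hN]

/-- Union bound over pairs of indices. As `o` has at most one element, each pair contains a
coordinate of h; conditionally on the rest it is uniform modulo p, so it hits the other entry with
probability 1/p. -/
theorem meanBox_collision_le (ho : o = ∅ ∨ o = {0}) {p N : ℕ} (hp : p.Prime) (hN : 0 < N)
    (hd : p ∣ N) : meanBox (k := k) N (fun h => collision p (joinTuple o h)) ≤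
      (Fintype.card (o ⊕ Fin k) : ℝ) ^ 2 / p := by
  classical
  have hp0 : (0 : ℝ) < p := by exact_mod_cast hp.pos
  have h1 : ∀ h : Fin k → ℤ, collision p (joinTuple o h) ≤
      ∑ x ∈ (Finset.univ : Finset (o ⊕ Fin k)).offDiag,
        if (p : ℤ) ∣ joinTuple o h x.1 - joinTuple o h x.2 then (1 : ℝ) else 0 := by
    intro h
    unfold collision diffProd
    split_ifs with hdv
    · obtain ⟨x, hx, hxd⟩ := (Nat.prime_iff_prime_int.1 hp).exists_mem_finset_dvd hdv
      have := Finset.single_le_sum (f := fun x : (o ⊕ Fin k) × (o ⊕ Fin k) =>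
        if (p : ℤ) ∣ joinTuple o h x.1 - joinTuple o h x.2 then (1 : ℝ) else 0)
        (fun x _ => by positivity) hx
      simp only [if_pos hxd] at this
      convert this
    · exact Finset.sum_nonneg fun x _ => by positivity
  refine (meanBox_mono h1).trans ?_
  rw [meanBox_sum]
  have h2 : ∀ x ∈ (Finset.univ : Finset (o ⊕ Fin k)).offDiag, meanBox (k := k) N (fun h =>
      if (p : ℤ) ∣ joinTuple o h x.1 - joinTuple o h x.2 then (1 : ℝ) else 0) ≤ 1 / p := by
    rintro ⟨x | i, y | i'⟩ hx
    · have hne : x ≠ y := fun e => (Finset.mem_offDiag.1 hx).2.2 (congrArg Sum.inl e)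
      refine absurd (Subtype.ext ?_) hne
      have hx := x.2
      have hy := y.2
      rcases ho with rfl | rfl
      · exact absurd hx (Finset.notMem_empty _)
      · rw [Finset.mem_singleton.1 hx, Finset.mem_singleton.1 hy]
    · simp only [joinTuple, Sum.elim_inl, Sum.elim_inr]
      simp only [dvd_sub_comm (b := (x : ℤ))]
      exact (meanBox_dvd_sub hN hd i' (c := fun _ => (x : ℤ)) fun _ _ => rfl).le
    · simp only [joinTuple, Sum.elim_inl, Sum.elim_inr]
      exact (meanBox_dvd_sub hN hd i (c := fun _ => (y : ℤ)) fun _ _ => rfl).le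
    · have hne : i' ≠ i := fun e => (Finset.mem_offDiag.1 hx).2.2 (congrArg Sum.inr e.symm)
      simp only [joinTuple, Sum.elim_inr]
      exact (meanBox_dvd_sub hN hd i (c := fun h => h i')
        fun h t => Function.update_of_ne hne _ _).le
  refine (Finset.sum_le_sum h2).trans ?_
  rw [Finset.sum_const, nsmul_eq_mul, mul_one_div]
  refine div_le_div_of_nonneg_right ?_ hp0.le
  have : (Finset.univ : Finset (o ⊕ Fin k)).offDiag.card ≤ Fintype.card (o ⊕ Fin k) ^ 2 := by
    rw [Finset.offDiag_card, Finset.card_univ, pow_two]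
    exact Nat.sub_le _ _
  exact_mod_cast this

theorem meanBox_abs_levelIncr_le (ho : o = ∅ ∨ o = {0}) {p : ℕ} (hp : p.Prime)
    (h1 : ¬ p ≡ 1 [MOD 4]) (j : ℕ) :
    meanBox (k := k) (p ^ (j + 1)) (fun h => |levelIncr p (j + 1) (joinTuple o h)|) ≤
      incrConst (Fintype.card (o ⊕ Fin k)) / (p : ℝ) ^ (j + 1) *
        (((Fintype.card (o ⊕ Fin k) : ℝ) ^ 2 + 1) / p) := by
  have hpos : 0 < p ^ (j + 1) := pow_pos hp.pos _
  refine (meanBox_mono fun h => abs_levelIncr_le hp h1 j (joinTuple o h)).trans ?_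
  rw [meanBox_mul_left, meanBox_add, meanBox_const hpos, add_div]
  refine mul_le_mul_of_nonneg_left (add_le_add_left ?_ _)
    (div_nonneg (incrConst_nonneg _) (by positivity))
  exact meanBox_collision_le ho hp hpos (dvd_pow_self p (Nat.succ_ne_zero j))

end Means

/-! ### Lattice points in dilates of convex sets -/

section Lattice

variable {k : ℕ}

/-- The integer vectors `m` with `m + v ∈ S`. -/
def latticeSet (S : Set (Fin k → ℝ)) (v : Fin k → ℝ) : Set (Fin k → ℤ) :=
  {m | (fun i => (m i : ℝ)) + v ∈ S}

theorem finite_latticeSet {C : Set (Fin k → ℝ)} (hC : Bornology.IsBounded C) (t : ℝ)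
    (v : Fin k → ℝ) : (latticeSet (t • C) v).Finite := by
  obtain ⟨R, hR⟩ := (hC.smul₀ t).exists_norm_le
  refine (Set.Finite.pi' (fun _ : Fin k => Set.finite_Icc (-⌈R + ‖v‖⌉) ⌈R + ‖v‖⌉)).subset ?_
  intro h hh i
  have h0 : ‖(fun i => (h i : ℝ))‖ ≤ R + ‖v‖ := by
    have := norm_sub_le ((fun i => (h i : ℝ)) + v) v
    rw [add_sub_cancel_right] at this
    exact this.trans (add_le_add_left (hR _ hh) _)
  have h1 : |(h i : ℝ)| ≤ R + ‖v‖ := (norm_le_pi_norm (fun i => (h i : ℝ)) i).trans h0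
  have h2 := abs_le.1 (h1.trans (Int.le_ceil _))
  constructor
  · exact_mod_cast h2.1
  · exact_mod_cast h2.2

/-- The half-open unit cube with lowest corner `m`. -/
def cube (m : Fin k → ℤ) : Set (Fin k → ℝ) :=
  Set.univ.pi fun i => Set.Ico (m i : ℝ) (m i + 1)

theorem volume_cube (m : Fin k → ℤ) : MeasureTheory.volume (cube m) = 1 := by
  simp [cube, MeasureTheory.volume_pi_pi]

theorem measurableSet_cube (m : Fin k → ℤ) : MeasurableSet (cube m) :=
  MeasurableSet.univ_pi fun _ => measurableSet_Ico

theorem mem_cube_iff {m : Fin k → ℤ} {x : Fin k → ℝ} : x ∈ cube m ↔ ∀ i, ⌊x i⌋ = m i := by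
  simp [cube, Set.mem_pi, Int.floor_eq_iff]

theorem pairwise_disjoint_cube : Pairwise fun m m' : Fin k → ℤ => Disjoint (cube m) (cube m') := by
  intro m m' hne
  refine Set.disjoint_left.2 fun x hx hx' => hne (funext fun i => ?_)
  rw [← mem_cube_iff.1 hx i, mem_cube_iff.1 hx' i]

theorem volume_biUnion_cube (s : Finset (Fin k → ℤ)) :
    MeasureTheory.volume (⋃ m ∈ s, cube m) = s.card := by
  rw [MeasureTheory.measure_biUnion_finset (fun m _ m' _ h => pairwise_disjoint_cube h)
    fun m _ => measurableSet_cube m]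
  simp [volume_cube]

theorem norm_sub_le_one_of_mem_cube {m : Fin k → ℤ} {x : Fin k → ℝ} (hx : x ∈ cube m) :
    ‖x - fun i => (m i : ℝ)‖ ≤ 1 := by
  refine (pi_norm_le_iff_of_nonneg zero_le_one).2 fun i => ?_
  have := hx i (Set.mem_univ i)
  rw [Pi.sub_apply, Real.norm_eq_abs, abs_le]
  constructor <;> linarith [this.1, this.2]

theorem volume_smul_add {C : Set (Fin k → ℝ)} {t : ℝ} (ht : 0 ≤ t) (v : Fin k → ℝ) :
    MeasureTheory.volume {x | x + v ∈ t • C} = ENNReal.ofReal (t ^ k) * MeasureTheory.volume C := by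
  have : {x | x + v ∈ t • C} = (fun x => x + v) ⁻¹' (t • C) := rfl
  rw [this, MeasureTheory.measure_preimage_add_right, MeasureTheory.Measure.addHaar_smul]
  simp [abs_of_nonneg ht]

/-- A translate of l • C contains the closed unit ball of the sup norm, and convexity gives sC + lC
= (s + l)C for s ≥ 0. So the union of the unit cubes at the lattice points lies in a translate of (t
+ l)C and, if l ≤ t, contains a translate of (t - l)C. Volumes are compared. -/
theorem abs_ncard_latticeSet_sub_le_of_ball {C : Set (Fin k → ℝ)} (hC : Bornology.IsBounded C)
    (hconv : Convex ℝ C) {x₀ : Fin k → ℝ} {l : ℝ} (hl : 0 < l)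
    (hball : ∀ w : Fin k → ℝ, ‖w‖ ≤ l⁻¹ → x₀ + w ∈ C) {t : ℝ} (ht : 1 ≤ t) (v : Fin k → ℝ) :
    ((latticeSet (t • C) v).ncard : ℝ) ≤ (t + l) ^ k * (MeasureTheory.volume C).toReal ∧
      (l ≤ t → (t - l) ^ k * (MeasureTheory.volume C).toReal ≤ (latticeSet (t • C) v).ncard) := by
  have hfin := finite_latticeSet hC t v
  have hvol : MeasureTheory.volume C ≠ ⊤ := hC.measure_lt_top.ne
  have hball' : ∀ w : Fin k → ℝ, ‖w‖ ≤ 1 → x₀ + l⁻¹ • w ∈ C := by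
    intro w hw
    refine hball _ ?_
    rw [norm_smul, Real.norm_eq_abs, abs_of_pos (inv_pos.2 hl)]
    exact mul_le_of_le_one_right (inv_pos.2 hl).le hw
  have hcard : MeasureTheory.volume (⋃ m ∈ hfin.toFinset, cube m) =
      ENNReal.ofReal ((latticeSet (t • C) v).ncard : ℝ) := by
    rw [volume_biUnion_cube, Set.ncard_eq_toFinset_card _ hfin, ENNReal.ofReal_natCast]
  constructor
  · have hsub : (⋃ m ∈ hfin.toFinset, cube m) ⊆ {x | x + (v + l • x₀) ∈ (t + l) • C} := by
      intro x hx
      obtain ⟨m, hm, hxm⟩ := Set.mem_iUnion₂.1 hx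
      obtain ⟨c, hc, hcm⟩ := hfin.mem_toFinset.1 hm
      rw [Set.mem_ofPred_eq, hconv.add_smul (by linarith) hl.le]
      refine ⟨t • c, Set.smul_mem_smul_set hc, l • (x₀ + l⁻¹ • (x - fun i => (m i : ℝ))),
        Set.smul_mem_smul_set (hball' _ (norm_sub_le_one_of_mem_cube hxm)), ?_⟩
      simp only at hcm ⊢
      rw [hcm, smul_add, smul_inv_smul₀ hl.ne']
      abel
    have := MeasureTheory.measure_mono (μ := MeasureTheory.volume) hsub
    rw [hcard, volume_smul_add (by linarith), ← ENNReal.ofReal_toReal hvol,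
      ← ENNReal.ofReal_mul (by positivity), ENNReal.ofReal_le_ofReal_iff (by positivity)] at this
    exact this
  · intro hlt
    have hsub : {x | x + (v + (-l) • x₀) ∈ (t - l) • C} ⊆ ⋃ m ∈ hfin.toFinset, cube m := by
      rintro x ⟨c, hc, hcx⟩
      have hxm : x ∈ cube (fun i => ⌊x i⌋) := mem_cube_iff.2 fun _ => rfl
      refine Set.mem_iUnion₂.2 ⟨_, hfin.mem_toFinset.2 ?_, hxm⟩
      have e : t • C = (t - l) • C + l • C := by
        rw [← hconv.add_smul (by linarith) hl.le, sub_add_cancel]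
      rw [latticeSet, Set.mem_ofPred_eq, e]
      refine ⟨(t - l) • c, Set.smul_mem_smul_set hc,
        l • (x₀ + l⁻¹ • -(x - fun i => ((⌊x i⌋ : ℤ) : ℝ))),
        Set.smul_mem_smul_set (hball' _ ?_), ?_⟩
      · rw [norm_neg]
        exact norm_sub_le_one_of_mem_cube hxm
      · simp only at hcx ⊢
        rw [hcx, smul_add, smul_inv_smul₀ hl.ne', neg_smul]
        abel
    have := MeasureTheory.measure_mono (μ := MeasureTheory.volume) hsub
    rw [hcard, volume_smul_add (by linarith), ← ENNReal.ofReal_toReal hvol,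
      ← ENNReal.ofReal_mul (pow_nonneg (by linarith) _),
      ENNReal.ofReal_le_ofReal_iff (by positivity)] at this
    exact this

/-- A nonempty convex set without interior spans a proper affine subspace, so some nonzero
functional is constant on it; that functional is nonzero on some basis vector. -/
theorem exists_coordinate_of_interior_eq_empty {C : Set (Fin k → ℝ)} (hconv : Convex ℝ C)
    (hC : C.Nonempty) (hint : interior C = ∅) : ∃ (f : (Fin k → ℝ) →ₗ[ℝ] ℝ) (i : Fin k),
      f (Pi.single i 1) ≠ 0 ∧ ∀ x ∈ C, ∀ y ∈ C, f x = f y := by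
  have h1 : affineSpan ℝ C ≠ ⊤ := by
    rw [Ne, ← hconv.interior_nonempty_iff_affineSpan_eq_top, hint]
    exact Set.not_nonempty_empty
  have h2 : vectorSpan ℝ C < ⊤ := by
    rw [lt_top_iff_ne_top]
    intro h
    exact h1 ((AffineSubspace.affineSpan_eq_top_iff_vectorSpan_eq_top_of_nonempty ℝ _ _ hC).2 h)
  obtain ⟨f, hf, hle⟩ := Submodule.exists_le_ker_of_lt_top _ h2
  obtain ⟨i, hi⟩ : ∃ i, f (Pi.single i 1) ≠ 0 := by
    by_contra! hc
    exact hf (LinearMap.pi_ext' fun i => LinearMap.ext_ring (by simpa using hc i))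
  refine ⟨f, i, hi, fun x hx y hy => ?_⟩
  have := hle (vsub_mem_vectorSpan ℝ hx hy)
  rwa [LinearMap.mem_ker, vsub_eq_sub, map_sub, sub_eq_zero] at this

/-- Since f is constant on C and f(e_i) ≠ 0, the i-th coordinate of a lattice point is determined by
the others, each of which takes at most (2R + 2)t values. -/
theorem ncard_latticeSet_le_of_interior_eq_empty {C : Set (Fin k → ℝ)} {R : ℝ}
    (hC : ∀ x ∈ C, ‖x‖ ≤ R) (hR : 0 ≤ R) (hconv : Convex ℝ C) (hint : interior C = ∅)
    {t : ℝ} (ht : 1 ≤ t) (v : Fin k → ℝ) :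
    ((latticeSet (t • C) v).ncard : ℝ) ≤ ((2 * R + 2) * t) ^ (k - 1) := by
  rcases C.eq_empty_or_nonempty with rfl | hne
  · simp only [Set.smul_set_empty, latticeSet, Set.mem_empty_iff_false, Set.ofPred_false,
      Set.ncard_empty, Nat.cast_zero]
    positivity
  obtain ⟨f, i, hi, hf⟩ := exists_coordinate_of_interior_eq_empty hconv hne hint
  set I : {j : Fin k // j ≠ i} → Finset ℤ := fun j => Finset.Icc ⌈-(t * R) - v j⌉ ⌊t * R - v j⌋
  have hmaps : ∀ m ∈ latticeSet (t • C) v, (fun j : {j : Fin k // j ≠ i} => m j) ∈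
      (Fintype.piFinset I : Set _) := by
    rintro m ⟨c, hc, hcm⟩
    refine Finset.mem_coe.2 (Fintype.mem_piFinset.2 fun j => ?_)
    have h1 : |t * c j| ≤ t * R := by
      rw [abs_mul, abs_of_nonneg (by linarith)]
      exact mul_le_mul_of_nonneg_left ((norm_le_pi_norm c j).trans (hC c hc)) (by linarith)
    have h2 : t * c j = m j + v j := congrFun hcm j
    rw [h2, abs_le] at h1
    refine Finset.mem_Icc.2 ⟨Int.ceil_le.2 ?_, Int.le_floor.2 ?_⟩ <;> linarith [h1.1, h1.2]
  have hinj : Set.InjOn (fun (m : Fin k → ℤ) (j : {j : Fin k // j ≠ i}) => m j)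
      (latticeSet (t • C) v) := by
    rintro m ⟨c, hc, hcm⟩ m' ⟨c', hc', hcm'⟩ e
    simp only at hcm hcm'
    have hoff : ∀ j ≠ i, m j = m' j := fun j hj => congrFun e ⟨j, hj⟩
    have h1 : t • c - t • c' = ((m i : ℝ) - m' i) • Pi.single i (1 : ℝ) := by
      rw [hcm, hcm']
      funext j
      by_cases hj : j = i
      · subst hj; simp
      · simp [hoff j hj, hj]
    have h2 := congrArg f h1
    rw [map_sub, map_smul, map_smul, map_smul, hf c hc c' hc', sub_self, eq_comm,
      smul_eq_zero] at h2
    have h3 := h2.resolve_right hi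
    funext j
    by_cases hj : j = i
    · subst hj
      exact_mod_cast sub_eq_zero.1 h3
    · exact hoff j hj
  have h1 := Set.ncard_le_ncard_of_injOn _ hmaps hinj
  rw [Set.ncard_coe_finset, Fintype.card_piFinset] at h1
  have h2 : ∀ j, ((I j).card : ℝ) ≤ (2 * R + 2) * t := by
    intro j
    rw [Int.card_Icc]
    have h3 : ((⌊t * R - v j⌋ + 1 - ⌈-(t * R) - v j⌉ : ℤ) : ℝ) ≤ (2 * R + 2) * t := by
      have := Int.floor_le (t * R - v j)
      have := Int.le_ceil (-(t * R) - v j)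
      push_cast
      nlinarith
    have h4 : 0 ≤ (2 * R + 2) * t := by positivity
    rw [← Int.cast_natCast, Int.toNat_eq_max, Int.cast_max]
    exact max_le h3 (by simpa using h4)
  calc ((latticeSet (t • C) v).ncard : ℝ) ≤ ((∏ j, (I j).card : ℕ) : ℝ) := by exact_mod_cast h1
    _ = ∏ j, ((I j).card : ℝ) := by push_cast; rfl
    _ ≤ ∏ _j : {j : Fin k // j ≠ i}, ((2 * R + 2) * t) :=
      Finset.prod_le_prod (fun _ _ => by positivity) fun j _ => h2 j
    _ = _ := by simp

theorem volume_eq_zero_of_interior_eq_empty {C : Set (Fin k → ℝ)} (hconv : Convex ℝ C)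
    (hint : interior C = ∅) : MeasureTheory.volume C = 0 := by
  refine MeasureTheory.measure_mono_null ?_ (hconv.addHaar_frontier MeasureTheory.volume)
  rw [frontier, hint, Set.sdiff_empty]
  exact subset_closure

/-- Counting lattice points of translates of dilates of a bounded convex set. -/
theorem exists_abs_ncard_latticeSet_sub_le (hk : 1 ≤ k) {C : Set (Fin k → ℝ)}
    (hC : Bornology.IsBounded C) (hconv : Convex ℝ C) :
    ∃ A : ℝ, 0 ≤ A ∧ ∀ t : ℝ, 1 ≤ t → ∀ v : Fin k → ℝ,
      |((latticeSet (t • C) v).ncard : ℝ) - t ^ k * (MeasureTheory.volume C).toReal| ≤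
        A * t ^ (k - 1) := by
  obtain ⟨n, rfl⟩ := Nat.exists_eq_add_of_le' hk
  rw [Nat.add_sub_cancel]
  rcases (interior C).eq_empty_or_nonempty with hint | ⟨x₀, hx₀⟩
  · obtain ⟨R, hR0, hR⟩ := hC.exists_pos_norm_le
    refine ⟨(2 * R + 2) ^ n, by positivity, fun t ht v => ?_⟩
    rw [volume_eq_zero_of_interior_eq_empty hconv hint, ENNReal.toReal_zero, mul_zero, sub_zero,
      Nat.abs_cast, ← mul_pow]
    exact ncard_latticeSet_le_of_interior_eq_empty hR hR0.le hconv hint ht v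
  · obtain ⟨r, hr, hball⟩ := Metric.isOpen_iff.1 isOpen_interior x₀ hx₀
    set l := (r / 2)⁻¹ with hl
    have hl0 : 0 < l := by positivity
    have hb : ∀ w : Fin (n + 1) → ℝ, ‖w‖ ≤ l⁻¹ → x₀ + w ∈ C := by
      intro w hw
      rw [hl, inv_inv] at hw
      refine interior_subset (hball ?_)
      rw [Metric.mem_ball, dist_eq_norm, add_sub_cancel_left]
      linarith
    set V := (MeasureTheory.volume C).toReal with hV
    have hV0 : 0 ≤ V := ENNReal.toReal_nonneg
    refine ⟨(n + 1) * l * (1 + l) ^ n * V, by positivity, fun t ht v => ?_⟩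
    have ht0 : 0 < t := by linarith
    obtain ⟨h1, h2⟩ := abs_ncard_latticeSet_sub_le_of_ball hC hconv hl0 hb ht v
    have hmain : (t + l) ^ (n + 1) - t ^ (n + 1) ≤ (n + 1) * l * (1 + l) ^ n * t ^ n := by
      -- Bernoulli's inequality for t/(t + l) = 1 - l/(t + l) yields (t + l)^(n+1) - t^(n+1) ≤ (n +
      -- 1) l (t + l)^n.
      have e1 : (1 + -(l / (t + l)) * ((n + 1 : ℕ) : ℝ)) ≤ (1 + -(l / (t + l))) ^ (n + 1) := by
        have hle : l / (t + l) ≤ 1 := (div_le_one (by positivity)).2 (by linarith)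
        have := one_add_mul_le_pow (a := -(l / (t + l))) (by linarith) (n + 1)
        linarith
      have e2 : (1 + -(l / (t + l))) * (t + l) = t := by field_simp; ring
      have e3 := mul_le_mul_of_nonneg_right e1 (by positivity : 0 ≤ (t + l) ^ (n + 1))
      rw [← mul_pow, e2] at e3
      have e4 : (1 + -(l / (t + l)) * ((n + 1 : ℕ) : ℝ)) * (t + l) ^ (n + 1) =
          (t + l) ^ (n + 1) - (n + 1) * l * (t + l) ^ n := by
        rw [pow_succ]
        push_cast
        field_simp
        ring
      rw [e4] at e3
      have e5 : (t + l) ^ n ≤ (1 + l) ^ n * t ^ n := by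
        rw [← mul_pow]
        exact pow_le_pow_left₀ (by positivity) (by nlinarith) n
      have e6 := mul_le_mul_of_nonneg_left e5 (by positivity : 0 ≤ ((n : ℝ) + 1) * l)
      linarith
    have hmain2 : t ^ (n + 1) - (n + 1) * l * (1 + l) ^ n * t ^ n ≤
        t ^ (n + 1) - (n + 1) * l * t ^ n := by
      have : 1 ≤ (1 + l) ^ n := one_le_pow₀ (by linarith)
      have h3 : 0 ≤ ((n : ℝ) + 1) * l * t ^ n := by positivity
      nlinarith
    rw [abs_le]
    constructor
    · by_cases hlt : l ≤ t
      · have h3 := h2 hlt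
        have e1 := one_add_mul_le_pow (a := -(l / t))
          (by linarith [(div_le_one ht0).2 hlt]) (n + 1)
        have e2 : (1 + -(l / t)) * t = t - l := by field_simp; ring
        have e3 := mul_le_mul_of_nonneg_right e1 (by positivity : 0 ≤ t ^ (n + 1))
        rw [← mul_pow, e2] at e3
        have e4 : (1 + ((n + 1 : ℕ) : ℝ) * -(l / t)) * t ^ (n + 1) =
            t ^ (n + 1) - (n + 1) * l * t ^ n := by
          rw [pow_succ]
          push_cast
          field_simp
          ring
        rw [e4] at e3
        have := mul_le_mul_of_nonneg_right (hmain2.trans e3) hV0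
        linarith
      -- For t < l the lower bound is trivial, since the claimed error exceeds the main term.
      · have h3 : t ^ (n + 1) - (n + 1) * l * t ^ n ≤ 0 := by
          rw [pow_succ]
          have h4 : 0 ≤ (n : ℝ) * (l * t ^ n) := by positivity
          have h5 : 0 ≤ t ^ n := by positivity
          nlinarith
        have := mul_le_mul_of_nonneg_right (hmain2.trans h3) hV0
        have h6 : (0 : ℝ) ≤ (latticeSet (t • C) v).ncard := Nat.cast_nonneg _
        linarith
    · have := mul_le_mul_of_nonneg_right hmain hV0
      linarith

/-- Sums of periodic functions over the lattice points of a dilated convex set. -/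
theorem exists_abs_sum_sub_le (hk : 1 ≤ k) {C : Set (Fin k → ℝ)}
    (hC : Bornology.IsBounded C) (hconv : Convex ℝ C) :
    ∃ A : ℝ, 0 ≤ A ∧ ∀ (d : ℕ) (y : ℝ), 0 < d → (d : ℝ) ≤ y → ∀ F : (Fin k → ℤ) → ℝ,
      IsPeriodic d F →
      |∑ h ∈ (finite_integerPoints hC y).toFinset, F h -
          y ^ k * (MeasureTheory.volume C).toReal * meanBox d F| ≤
        A * y ^ (k - 1) * (d * meanBox d (fun h => |F h|)) := by
  obtain ⟨A, hA, hlat⟩ := exists_abs_ncard_latticeSet_sub_le hk hC hconv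
  refine ⟨A, hA, fun d y hd hdy F hF => ?_⟩
  have hd0 : (0 : ℝ) < d := by exact_mod_cast hd
  set V := (MeasureTheory.volume C).toReal
  set S := (finite_integerPoints hC y).toFinset with hS
  -- Writing h = r + d m, the condition h ∈ yC becomes m + r/d ∈ (y/d)C. This is why the lattice
  -- count has to be uniform in the translation.
  have hcard : ∀ r : Fin k → ℤ, r ∈ box k d →
      ((S.filter fun h => (fun i => h i % (d : ℤ)) = r).card : ℝ) =
        (latticeSet ((y / d) • C) fun i => (r i : ℝ) / d).ncard := by
    intro r hr
    refine congrArg Nat.cast ?_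
    rw [← Set.ncard_coe_finset]
    symm
    refine Set.ncard_congr (fun m _ => fun i => r i + d * m i) ?_ ?_ ?_
    · rintro m ⟨c, hc, hcm⟩
      refine Finset.mem_coe.2 (Finset.mem_filter.2 ⟨?_, ?_⟩)
      · refine (Set.Finite.mem_toFinset _).2 ⟨c, hc, ?_⟩
        funext i
        have := congrFun hcm i
        simp only [Pi.smul_apply, smul_eq_mul, Pi.add_apply] at this ⊢
        push_cast
        field_simp at this
        linarith
      · funext i
        have := mem_box.1 hr i
        rw [Int.add_mul_emod_self_left, Int.emod_eq_of_lt this.1 this.2]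
    · intro m m' _ _ e
      funext i
      have := congrFun e i
      simpa [hd.ne'] using this
    · intro h hh
      obtain ⟨h1, h2⟩ := Finset.mem_filter.1 (Finset.mem_coe.1 hh)
      obtain ⟨c, hc, hch⟩ := (Set.Finite.mem_toFinset _).1 h1
      have e : ∀ i, r i + d * (h i / d) = h i := fun i => by
        rw [← congrFun h2 i]
        exact Int.emod_add_mul_ediv _ _
      refine ⟨fun i => h i / d, ⟨c, hc, ?_⟩, funext e⟩
      funext i
      have e1 := congrFun hch i
      have e2 : (r i : ℝ) + d * ((h i / d : ℤ) : ℝ) = h i := by exact_mod_cast e i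
      simp only [Pi.smul_apply, smul_eq_mul, Pi.add_apply] at e1 ⊢
      rw [div_mul_eq_mul_div, e1, ← e2]
      field_simp
      ring
  have hsum : ∑ h ∈ S, F h = ∑ r ∈ box k d,
      F r * (latticeSet ((y / d) • C) fun i => (r i : ℝ) / d).ncard := by
    rw [← Finset.sum_fiberwise_of_maps_to (s := S) (t := box k d)
      (g := fun h i => h i % (d : ℤ)) fun h _ => emod_mem_box hd h]
    refine Finset.sum_congr rfl fun r hr => ?_
    rw [← hcard r hr, mul_comm, ← nsmul_eq_mul, ← Finset.sum_const]
    refine Finset.sum_congr rfl fun h hh => hF _ _ fun i => ?_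
    rw [← (Finset.mem_filter.1 hh).2]
    exact (Int.mod_modEq _ _).symm
  have hmain : y ^ k * V * meanBox d F = ∑ r ∈ box k d, F r * ((y / d) ^ k * V) := by
    rw [← Finset.sum_mul, meanBox, div_pow]
    ring
  have h1 : 1 ≤ y / d := (one_le_div hd0).2 hdy
  rw [hsum, hmain, ← Finset.sum_sub_distrib]
  calc _ ≤ ∑ r ∈ box k d, |F r| * (A * (y / d) ^ (k - 1)) := by
        refine (Finset.abs_sum_le_sum_abs _ _).trans (Finset.sum_le_sum fun r _ => ?_)
        rw [← mul_sub, abs_mul]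
        exact mul_le_mul_of_nonneg_left (hlat _ h1 _) (abs_nonneg _)
    _ = _ := by
        rw [← Finset.sum_mul, meanBox, div_pow]
        obtain ⟨n, rfl⟩ := Nat.exists_eq_add_of_le' hk
        rw [Nat.add_sub_cancel, pow_succ (d : ℝ)]
        field_simp

end Lattice

/-! ### Expansion over moduli -/

theorem coprime_pow {κ : Type*} {q : κ → ℕ} (hq : ∀ i, (q i).Prime) (hinj : Function.Injective q) (f : κ → ℕ) {i i' : κ}
    (hne : i ≠ i') : (q i ^ f i).Coprime (q i' ^ f i') :=
  Nat.Coprime.pow _ _ ((Nat.coprime_primes (hq i) (hq i')).2 (hinj.ne hne))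

section Expansion

variable {k : ℕ} {o : Finset ℤ} {κ : Type*} [Fintype κ] {q : κ → ℕ}

theorem prod_levelFactor_eq {ι : Type*} [Fintype ι] [DecidableEq κ] (q : κ → ℕ) (J : ℕ)
    (H : ι → ℤ) :
    ∏ i, levelFactor (q i) J H = ∑ f ∈ Fintype.piFinset (fun _ : κ => Finset.range (J + 1)),
      ∏ i, levelIncr (q i) (f i) H := by
  simp only [← sum_levelIncr]
  rw [Finset.prod_univ_sum]

theorem isPeriodic_levelIncr (o : Finset ℤ) (p j : ℕ) :
    IsPeriodic (p ^ j) (fun h : Fin k → ℤ => levelIncr p j (joinTuple o h)) :=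
  fun _ _ e => levelIncr_congr (joinTuple_congr o e)

theorem isPeriodic_abs {N : ℕ} {F : (Fin k → ℤ) → ℝ} (hF : IsPeriodic N F) :
    IsPeriodic N (fun h => |F h|) :=
  fun h h' e => congrArg _ (hF h h' e)

theorem meanBox_prod_levelIncr (ho : o = ∅ ∨ o = {0}) (hq : ∀ i, (q i).Prime)
    (hinj : Function.Injective q) {f : κ → ℕ} (hf : f ≠ 0) :
    meanBox (k := k) (∏ i, q i ^ f i) (fun h => ∏ i, levelIncr (q i) (f i) (joinTuple o h)) =
      0 := by
  rw [meanBox_prod_of_coprime Finset.univ _ (fun i _ => pow_pos (hq i).pos _)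
    (fun i _ i' _ hne => coprime_pow hq hinj f hne)
    (fun i h => levelIncr (q i) (f i) (joinTuple o h)) fun i _ => isPeriodic_levelIncr o _ _]
  obtain ⟨i, hi⟩ := Function.ne_iff.1 hf
  obtain ⟨j, hj⟩ := Nat.exists_eq_succ_of_ne_zero hi
  refine Finset.prod_eq_zero (Finset.mem_univ i) ?_
  rw [hj]
  exact meanBox_levelIncr ho (hq i) j

theorem meanBox_abs_prod_levelIncr (hq : ∀ i, (q i).Prime)
    (hinj : Function.Injective q) (f : κ → ℕ) :
    meanBox (k := k) (∏ i, q i ^ f i) (fun h => |∏ i, levelIncr (q i) (f i) (joinTuple o h)|) =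
      ∏ i, meanBox (k := k) (q i ^ f i) (fun h => |levelIncr (q i) (f i) (joinTuple o h)|) := by
  simp only [Finset.abs_prod]
  exact meanBox_prod_of_coprime Finset.univ _ (fun i _ => pow_pos (hq i).pos _)
    (fun i _ i' _ hne => coprime_pow hq hinj f hne)
    (fun i h => |levelIncr (q i) (f i) (joinTuple o h)|)
    fun i _ => isPeriodic_abs (isPeriodic_levelIncr o _ _)

/-- Rankin's trick on the expansion over exponent vectors f, with modulus d. If d ≤ y, the lattice
estimate applies, the mean vanishes unless f = 0, and in the error d ≤ y^(1/3) d^(2/3). If d > y,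
absolute values are taken and 1 ≤ (d/y)^(2/3) is inserted. The weight d^(2/3) is multiplicative, so
both sums over f factor into products over the primes. Any weight exponent below 1 would lead to
convergent products; 2/3 is the one the claim requires. -/
theorem abs_sum_prod_levelFactor_sub_le (ho : o = ∅ ∨ o = {0}) (hq : ∀ i, (q i).Prime)
    (hinj : Function.Injective q) {S : Finset (Fin k → ℤ)} {y V A : ℝ} (hy : 1 ≤ y) (hA : 0 ≤ A)
    (hS : ∀ d : ℕ, 0 < d → (d : ℝ) ≤ y → ∀ F : (Fin k → ℤ) → ℝ, IsPeriodic d F →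
      |∑ h ∈ S, F h - y ^ k * V * meanBox d F| ≤
        A * y ^ (k - 1) * (d * meanBox d (fun h => |F h|))) (J : ℕ) :
    |∑ h ∈ S, ∏ i, levelFactor (q i) J (joinTuple o h) - y ^ k * V| ≤
      A * y ^ (k - 1) * y ^ (1 / 3 : ℝ) * ∏ i, ∑ j ∈ Finset.range (J + 1),
        ((q i ^ j : ℕ) : ℝ) ^ (2 / 3 : ℝ) *
          meanBox (k := k) (q i ^ j) (fun h => |levelIncr (q i) j (joinTuple o h)|) +
      y ^ (-(2 / 3) : ℝ) * ∑ h ∈ S, ∏ i, ∑ j ∈ Finset.range (J + 1),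
        ((q i ^ j : ℕ) : ℝ) ^ (2 / 3 : ℝ) * |levelIncr (q i) j (joinTuple o h)| := by
  classical
  have hy0 : 0 < y := by linarith
  set Φ := Fintype.piFinset (fun _ : κ => Finset.range (J + 1)) with hΦ
  set g : (κ → ℕ) → (Fin k → ℤ) → ℝ :=
    fun f h => ∏ i, levelIncr (q i) (f i) (joinTuple o h) with hg
  set d : (κ → ℕ) → ℕ := fun f => ∏ i, q i ^ f i with hd
  have hd0 : ∀ f, 0 < d f := fun f => Finset.prod_pos fun i _ => pow_pos (hq i).pos _
  have hmain : ∑ f ∈ Φ, (if f = 0 then y ^ k * V else 0) = y ^ k * V := by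
    rw [Finset.sum_ite_eq' Φ 0, if_pos]
    simp [hΦ]
  have hexp : ∑ h ∈ S, ∏ i, levelFactor (q i) J (joinTuple o h) = ∑ f ∈ Φ, ∑ h ∈ S, g f h := by
    simp only [prod_levelFactor_eq]
    rw [Finset.sum_comm]
  have hone : ∀ f, |∑ h ∈ S, g f h - if f = 0 then y ^ k * V else 0| ≤
      A * y ^ (k - 1) * y ^ (1 / 3 : ℝ) * ((d f : ℝ) ^ (2 / 3 : ℝ) *
        meanBox (d f) (fun h => |g f h|)) +
      y ^ (-(2 / 3) : ℝ) * ∑ h ∈ S, (d f : ℝ) ^ (2 / 3 : ℝ) * |g f h| := by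
    intro f
    have hdf : (0 : ℝ) < d f := by exact_mod_cast hd0 f
    have hmn : 0 ≤ meanBox (d f) (fun h => |g f h|) := meanBox_nonneg fun h => abs_nonneg _
    have hn2 : 0 ≤ y ^ (-(2 / 3) : ℝ) * ∑ h ∈ S, (d f : ℝ) ^ (2 / 3 : ℝ) * |g f h| := by
      refine mul_nonneg (by positivity) (Finset.sum_nonneg fun h _ => by positivity)
    have hn1 : 0 ≤ A * y ^ (k - 1) * y ^ (1 / 3 : ℝ) * ((d f : ℝ) ^ (2 / 3 : ℝ) *
        meanBox (d f) (fun h => |g f h|)) := by positivity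
    by_cases hle : (d f : ℝ) ≤ y
    · have hper : IsPeriodic (d f) (g f) :=
        isPeriodic_prod Finset.univ _ (fun i h => levelIncr (q i) (f i) (joinTuple o h))
          fun i _ => isPeriodic_levelIncr o _ _
      have h1 := hS (d f) (hd0 f) hle (g f) hper
      have h2 : y ^ k * V * meanBox (d f) (g f) = if f = 0 then y ^ k * V else 0 := by
        split_ifs with h0
        · have : g f = fun _ => 1 := by
            funext h
            simp [hg, h0, levelIncr, levelFactor_zero]
          rw [this, meanBox_const (hd0 f), mul_one]
        · rw [show meanBox (d f) (g f) = 0 from meanBox_prod_levelIncr ho hq hinj h0, mul_zero]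
      rw [h2] at h1
      have h3 : (d f : ℝ) ≤ y ^ (1 / 3 : ℝ) * (d f : ℝ) ^ (2 / 3 : ℝ) := by
        calc (d f : ℝ) = (d f : ℝ) ^ (1 / 3 : ℝ) * (d f : ℝ) ^ (2 / 3 : ℝ) := by
              rw [← Real.rpow_add hdf]; norm_num
          _ ≤ _ := by gcongr
      calc _ ≤ _ := h1
        _ ≤ A * y ^ (k - 1) * ((y ^ (1 / 3 : ℝ) * (d f : ℝ) ^ (2 / 3 : ℝ)) *
            meanBox (d f) (fun h => |g f h|)) := by gcongr
        _ = A * y ^ (k - 1) * y ^ (1 / 3 : ℝ) * ((d f : ℝ) ^ (2 / 3 : ℝ) *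
            meanBox (d f) (fun h => |g f h|)) := by ring
        _ ≤ _ := le_add_of_nonneg_right hn2
    · have h0 : f ≠ 0 := by
        rintro rfl
        exact hle (by simpa [hd] using hy)
      rw [if_neg h0, sub_zero]
      refine le_trans ?_ (le_add_of_nonneg_left hn1)
      refine (Finset.abs_sum_le_sum_abs _ _).trans ?_
      rw [← Finset.mul_sum, ← mul_assoc]
      refine le_mul_of_one_le_left (Finset.sum_nonneg fun h _ => abs_nonneg _) ?_
      calc (1 : ℝ) = y ^ (-(2 / 3) : ℝ) * y ^ (2 / 3 : ℝ) := by
            rw [← Real.rpow_add hy0]; norm_num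
        _ ≤ _ := by gcongr; exact (not_le.1 hle).le
  have hw : ∀ f : κ → ℕ, (d f : ℝ) ^ (2 / 3 : ℝ) = ∏ i, ((q i ^ f i : ℕ) : ℝ) ^ (2 / 3 : ℝ) := by
    intro f
    rw [hd, Real.finsetProd_rpow _ _ fun i _ => by positivity]
    push_cast
    rfl
  rw [hexp]
  nth_rewrite 1 [← hmain]
  rw [← Finset.sum_sub_distrib]
  refine (Finset.abs_sum_le_sum_abs _ _).trans ((Finset.sum_le_sum fun f _ => hone f).trans ?_)
  rw [Finset.sum_add_distrib, ← Finset.mul_sum, ← Finset.mul_sum, Finset.sum_comm]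
  refine le_of_eq (congrArg₂ _ (congrArg _ ?_) (congrArg _ (Finset.sum_congr rfl fun h _ => ?_)))
  · rw [Finset.prod_univ_sum]
    refine Finset.sum_congr rfl fun f _ => ?_
    rw [hw, hg, meanBox_abs_prod_levelIncr hq hinj f, Finset.prod_mul_distrib]
  · rw [Finset.prod_univ_sum]
    refine Finset.sum_congr rfl fun f _ => ?_
    rw [hw, hg, Finset.abs_prod, Finset.prod_mul_distrib]

end Expansion

/-! ### Estimates for Euler products -/

theorem weighted_sum_le {p : ℕ} (hp : p.Prime) {a : ℕ → ℝ} {C E : ℝ} (hC : 0 ≤ C) (hE : 0 ≤ E)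
    (h0 : a 0 = 1) (ha : ∀ j, a (j + 1) ≤ C / (p : ℝ) ^ (j + 1) * E) (J : ℕ) :
    ∑ j ∈ Finset.range (J + 1), ((p ^ j : ℕ) : ℝ) ^ (2 / 3 : ℝ) * a j ≤
      1 + 5 * C * (p : ℝ) ^ (-(1 / 3) : ℝ) * E := by
  have hp0 : (0 : ℝ) < p := by exact_mod_cast hp.pos
  set r := (p : ℝ) ^ (-(1 / 3) : ℝ) with hr
  have hr0 : 0 < r := by positivity
  -- As (4/5)³ > 1/2 ≥ 1/p, the geometric series of ratio r = p^(-1/3) is at most 5.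
  have hr1 : r ≤ 4 / 5 := by
    have h3 : r ^ 3 = (p : ℝ)⁻¹ := by
      rw [hr, ← Real.rpow_natCast, ← Real.rpow_mul hp0.le, ← Real.rpow_neg_one]
      norm_num
    have h2 : (p : ℝ)⁻¹ ≤ 2⁻¹ := inv_anti₀ (by norm_num) (by exact_mod_cast hp.two_le)
    by_contra! hc
    have := pow_lt_pow_left₀ hc (by norm_num) three_ne_zero
    rw [h3] at this
    norm_num at this h2
    linarith
  have hterm : ∀ j, ((p ^ (j + 1) : ℕ) : ℝ) ^ (2 / 3 : ℝ) * a (j + 1) ≤ C * E * r * r ^ j := by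
    intro j
    have e : ((p ^ (j + 1) : ℕ) : ℝ) ^ (2 / 3 : ℝ) = (p : ℝ) ^ (j + 1) * r ^ (j + 1) := by
      rw [hr, ← Real.rpow_natCast, ← Real.rpow_natCast, ← Real.rpow_mul hp0.le,
        ← Real.rpow_add hp0, Nat.cast_pow, ← Real.rpow_natCast, ← Real.rpow_mul hp0.le]
      congr 1
      ring
    calc _ ≤ ((p : ℝ) ^ (j + 1) * r ^ (j + 1)) * (C / (p : ℝ) ^ (j + 1) * E) := by
          rw [e]
          exact mul_le_mul_of_nonneg_left (ha j) (by positivity)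
      _ = _ := by field_simp; ring
  have hgeom : ∑ j ∈ Finset.range J, r ^ j ≤ 5 := by
    have h1 := geom_sum_mul r J
    have h2 : 0 ≤ r ^ J := by positivity
    have h3 : 0 ≤ ∑ j ∈ Finset.range J, r ^ j := Finset.sum_nonneg fun _ _ => by positivity
    nlinarith
  rw [Finset.sum_range_succ', h0]
  have h4 : ∑ j ∈ Finset.range J, ((p ^ (j + 1) : ℕ) : ℝ) ^ (2 / 3 : ℝ) * a (j + 1) ≤
      5 * C * r * E := by
    refine (Finset.sum_le_sum fun j _ => hterm j).trans ?_
    rw [← Finset.mul_sum]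
    have := mul_le_mul_of_nonneg_left hgeom (by positivity : 0 ≤ C * E * r)
    linarith
  simp only [pow_zero, Nat.cast_one, Real.one_rpow, mul_one]
  linarith

theorem prod_one_add_le {κ : Type*} [Fintype κ] {q : κ → ℕ} (hinj : Function.Injective q) {B : ℝ}
    (hB : 0 ≤ B) : ∏ i, (1 + B * (q i : ℝ) ^ (-(4 / 3) : ℝ)) ≤
      Real.exp (B * ∑' n : ℕ, (n : ℝ) ^ (-(4 / 3) : ℝ)) := by
  classical
  have hs : Summable fun n : ℕ => (n : ℝ) ^ (-(4 / 3) : ℝ) :=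
    Real.summable_nat_rpow.2 (by norm_num)
  calc _ ≤ ∏ i, Real.exp (B * (q i : ℝ) ^ (-(4 / 3) : ℝ)) := by
        refine Finset.prod_le_prod (fun i _ => by positivity) fun i _ => ?_
        rw [add_comm]
        exact Real.add_one_le_exp _
    _ = Real.exp (B * ∑ i, (q i : ℝ) ^ (-(4 / 3) : ℝ)) := by
        rw [← Real.exp_sum, Finset.mul_sum]
    _ ≤ _ := by
        refine Real.exp_le_exp.2 (mul_le_mul_of_nonneg_left ?_ hB)
        rw [← Finset.sum_image (f := fun n : ℕ => (n : ℝ) ^ (-(4 / 3) : ℝ)) (g := q)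
          fun i _ i' _ h => hinj h]
        exact hs.sum_le_tsum _ fun n _ => by positivity

/-- A divisor bound: a product of bounded factors over the primes dividing `D` is `≪ |D| ^ ε`. -/
theorem exists_prod_ite_dvd_le {B ε : ℝ} (hB : 1 ≤ B) (hε : 0 < ε) :
    ∃ C : ℝ, 0 ≤ C ∧ ∀ {κ : Type} [Fintype κ] (q : κ → ℕ), (∀ i, (q i).Prime) →
      Function.Injective q → ∀ D : ℕ, D ≠ 0 →
        ∏ i, (if q i ∣ D then B else 1) ≤ C * (D : ℝ) ^ ε := by
  classical
  obtain ⟨N, hN⟩ : ∃ N : ℕ, B ≤ (N : ℝ) ^ ε :=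
    (((tendsto_rpow_atTop hε).comp tendsto_natCast_atTop_atTop).eventually_ge_atTop B).exists
  refine ⟨B ^ N, by positivity, fun {κ} _ q hq hinj D hD => ?_⟩
  -- At most N primes lie below N, and they cost B each. A larger prime q has B ≤ q^ε, and the
  -- product of the distinct primes dividing D is at most D.
  have h1 : ∀ i, (if q i ∣ D then B else 1) ≤
      (if q i < N then B else 1) * if q i ∣ D then (q i : ℝ) ^ ε else 1 := by
    intro i
    have hq1 : 1 ≤ (q i : ℝ) ^ ε := Real.one_le_rpow (by exact_mod_cast (hq i).one_le) hε.le
    split_ifs with hd hlt hlt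
    · nlinarith
    · rw [one_mul]
      refine hN.trans (Real.rpow_le_rpow (by positivity) ?_ hε.le)
      exact_mod_cast not_lt.1 hlt
    · rwa [mul_one]
    · norm_num
  have h2 : ∏ i, (if q i < N then B else 1) ≤ B ^ N := by
    rw [Finset.prod_ite, Finset.prod_const_one, mul_one, Finset.prod_const]
    refine pow_le_pow_right₀ hB ?_
    rw [← Finset.card_range N]
    refine Finset.card_le_card_of_injOn q (fun i hi => ?_) hinj.injOn
    simpa using hi
  have h3 : ∏ i, (if q i ∣ D then (q i : ℝ) ^ ε else 1) ≤ (D : ℝ) ^ ε := by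
    rw [Finset.prod_ite, Finset.prod_const_one, mul_one,
      Real.finsetProd_rpow _ _ fun i _ => by positivity]
    refine Real.rpow_le_rpow (by positivity) ?_ hε.le
    have : ∏ i with q i ∣ D, q i ∣ D := by
      rw [← Finset.prod_image (f := fun n => n) fun i _ i' _ h => hinj h]
      refine Finset.prod_primes_dvd _ ?_ ?_ <;> intro a ha <;>
        obtain ⟨i, hi, rfl⟩ := Finset.mem_image.1 ha
      · exact (hq i).prime
      · exact (Finset.mem_filter.1 hi).2
    exact_mod_cast Nat.le_of_dvd (Nat.pos_of_ne_zero hD) this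
  calc _ ≤ ∏ i, ((if q i < N then B else 1) * if q i ∣ D then (q i : ℝ) ^ ε else 1) := by
        refine Finset.prod_le_prod (fun i _ => ?_) fun i _ => h1 i
        split_ifs <;> positivity
    _ ≤ _ := by
        rw [Finset.prod_mul_distrib]
        refine mul_le_mul h2 h3 (Finset.prod_nonneg fun i _ => ?_) (by positivity)
        split_ifs <;> positivity

/-! ### The average of the singular series -/

section Average

variable {k : ℕ} {o : Finset ℤ}

/-- On average over h, collisions cost only O(1/p), so each factor is 1 + O(p^(-1/3) · p^(-1)), and
∑ p^(-4/3) converges. The bound is uniform in the level and in the set of primes. -/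
theorem exists_sum_meanBox_le (k : ℕ) {o : Finset ℤ} (ho : o = ∅ ∨ o = {0}) :
    ∃ C : ℝ, 0 ≤ C ∧ ∀ {κ : Type} [Fintype κ] (q : κ → ℕ),
      (∀ i, (q i).Prime ∧ ¬ q i ≡ 1 [MOD 4]) → Function.Injective q → ∀ J : ℕ,
        ∏ i, ∑ j ∈ Finset.range (J + 1), ((q i ^ j : ℕ) : ℝ) ^ (2 / 3 : ℝ) *
          meanBox (k := k) (q i ^ j) (fun h => |levelIncr (q i) j (joinTuple o h)|) ≤ C := by
  set K := Fintype.card (o ⊕ Fin k) with hK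
  have hc := incrConst_nonneg K
  refine ⟨Real.exp (5 * incrConst K * ((K : ℝ) ^ 2 + 1) * ∑' n : ℕ, (n : ℝ) ^ (-(4 / 3) : ℝ)),
    (Real.exp_pos _).le, fun q hq hinj J => ?_⟩
  refine le_trans (Finset.prod_le_prod (fun i _ => ?_) fun i _ => ?_)
    (prod_one_add_le hinj (B := 5 * incrConst K * ((K : ℝ) ^ 2 + 1)) (by positivity))
  · exact Finset.sum_nonneg fun j _ =>
      mul_nonneg (by positivity) (meanBox_nonneg fun h => abs_nonneg _)
  · have hq0 : (0 : ℝ) < q i := by exact_mod_cast (hq i).1.pos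
    refine (weighted_sum_le (hq i).1 hc (E := ((K : ℝ) ^ 2 + 1) / q i) (by positivity) ?_
      (fun j => meanBox_abs_levelIncr_le ho (hq i).1 (hq i).2 j) J).trans (le_of_eq ?_)
    · simp [levelIncr, levelFactor_zero, meanBox_const]
    · have : (q i : ℝ) ^ (-(4 / 3) : ℝ) = (q i : ℝ) ^ (-(1 / 3) : ℝ) / q i := by
        rw [← Real.rpow_sub_one hq0.ne']
        norm_num
      rw [this]
      ring

/-- For fixed H, the primes not dividing `diffProd H` contribute factors 1 + O(p^(-4/3)), as in the
averaged bound. Each other prime contributes an additional bounded factor, and the divisor bound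
controls their product. -/
theorem exists_prod_sum_le (K : ℕ) {ε : ℝ} (hε : 0 < ε) :
    ∃ C : ℝ, 0 ≤ C ∧ ∀ {κ : Type} [Fintype κ] (q : κ → ℕ),
      (∀ i, (q i).Prime ∧ ¬ q i ≡ 1 [MOD 4]) → Function.Injective q → ∀ J : ℕ,
        ∀ {ι : Type} [Fintype ι] (H : ι → ℤ), Fintype.card ι = K → Function.Injective H →
          ∏ i, ∑ j ∈ Finset.range (J + 1), ((q i ^ j : ℕ) : ℝ) ^ (2 / 3 : ℝ) *
            |levelIncr (q i) j H| ≤ C * ((diffProd H).natAbs : ℝ) ^ ε := by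
  have hc := incrConst_nonneg K
  obtain ⟨C, hC, hprod⟩ := exists_prod_ite_dvd_le (B := 1 + 5 * incrConst K) (by linarith) hε
  refine ⟨Real.exp (5 * incrConst K * ∑' n : ℕ, (n : ℝ) ^ (-(4 / 3) : ℝ)) * C, by positivity, ?_⟩
  intro κ _ q hq hinj J ι _ H hcard hH
  have hD : (diffProd H).natAbs ≠ 0 := by
    rw [Int.natAbs_ne_zero, diffProd, Finset.prod_ne_zero_iff]
    exact fun x hx => sub_ne_zero.2 (hH.ne (Finset.mem_offDiag.1 hx).2.2)
  have hfac : ∀ i, ∑ j ∈ Finset.range (J + 1), ((q i ^ j : ℕ) : ℝ) ^ (2 / 3 : ℝ) *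
      |levelIncr (q i) j H| ≤ (1 + 5 * incrConst K * (q i : ℝ) ^ (-(4 / 3) : ℝ)) *
        if q i ∣ (diffProd H).natAbs then 1 + 5 * incrConst K else 1 := by
    intro i
    have hq0 : (0 : ℝ) < q i := by exact_mod_cast (hq i).1.pos
    have hq1 : (1 : ℝ) ≤ q i := by exact_mod_cast (hq i).1.one_le
    have hcoll := collision_nonneg (q i) H
    refine (weighted_sum_le (hq i).1 hc (E := collision (q i) H + 1 / q i) (by positivity) ?_
      (fun j => ?_) J).trans ?_
    · simp [levelIncr, levelFactor_zero]
    · rw [← hcard]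
      exact abs_levelIncr_le (hq i).1 (hq i).2 j H
    · have e : (q i : ℝ) ^ (-(4 / 3) : ℝ) = (q i : ℝ) ^ (-(1 / 3) : ℝ) * (1 / q i) := by
        rw [mul_one_div, ← Real.rpow_sub_one hq0.ne']
        norm_num
      have hle : (q i : ℝ) ^ (-(1 / 3) : ℝ) ≤ 1 :=
        Real.rpow_le_one_of_one_le_of_nonpos hq1 (by norm_num)
      have hr0 : 0 < (q i : ℝ) ^ (-(1 / 3) : ℝ) := by positivity
      rw [e]
      set r := (q i : ℝ) ^ (-(1 / 3) : ℝ)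
      have hi : (0 : ℝ) < 1 / q i := by positivity
      by_cases hd : q i ∣ (diffProd H).natAbs
      · rw [if_pos hd, collision, if_pos (Int.natCast_dvd.2 hd)]
        have h1 : 5 * incrConst K * r ≤ 5 * incrConst K * 1 :=
          mul_le_mul_of_nonneg_left hle (by positivity)
        have h2 : 0 ≤ 5 * incrConst K * (r * (1 / q i)) * (5 * incrConst K) := by positivity
        nlinarith
      · rw [if_neg hd, collision, if_neg (fun h => hd (Int.natCast_dvd.1 h))]
        exact le_of_eq (by ring)
  refine (Finset.prod_le_prod (fun i _ => Finset.sum_nonneg fun j _ => by positivity)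
    fun i _ => hfac i).trans ?_
  rw [Finset.prod_mul_distrib, mul_assoc]
  refine mul_le_mul (prod_one_add_le hinj (by positivity))
    (hprod q (fun i => (hq i).1) hinj _ hD) (Finset.prod_nonneg fun i _ => ?_) (Real.exp_pos _).le
  split_ifs <;> positivity

theorem natAbs_diffProd_le {ι : Type*} [Fintype ι] {H : ι → ℤ} {M : ℝ} (hM : 1 ≤ M)
    (hH : ∀ x y, |((H x - H y : ℤ) : ℝ)| ≤ M) :
    ((diffProd H).natAbs : ℝ) ≤ M ^ (Fintype.card ι ^ 2) := by
  classical
  rw [Nat.cast_natAbs, Int.cast_abs, diffProd, Int.cast_prod, Finset.abs_prod]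
  refine (Finset.prod_le_prod (fun _ _ => abs_nonneg _) fun x _ => hH x.1 x.2).trans ?_
  rw [Finset.prod_const]
  refine pow_le_pow_right₀ hM ?_
  rw [Finset.offDiag_card, Finset.card_univ, pow_two]
  exact Nat.sub_le _ _

theorem injective_joinTuple (ho : o = ∅ ∨ o = {0}) {h : Fin k → ℤ} (hpos : ∀ i, 0 < h i)
    (hinj : Function.Injective h) : Function.Injective (joinTuple o h) := by
  have h0 : ∀ x : o, (x : ℤ) = 0 := by
    rintro ⟨x, hx⟩
    rcases ho with rfl | rfl
    · exact absurd hx (Finset.notMem_empty _)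
    · exact Finset.mem_singleton.1 hx
  refine Function.Injective.sumElim Subtype.val_injective hinj fun x i => ?_
  rw [h0 x]
  exact (hpos i).ne

theorem image_joinTuple (o : Finset ℤ) (h : Fin k → ℤ) :
    Finset.univ.image (joinTuple o h) = o ∪ Finset.univ.image h := by
  ext n
  simp [joinTuple]

theorem exists_abs_sum_prod_levelFactor_sub_le (hk : 1 ≤ k) {C : Set (Fin k → ℝ)}
    (hC : Bornology.IsBounded C) (hconv : Convex ℝ C) (hsub : C ⊆ orderedRegion k)
    (ho : o = ∅ ∨ o = {0}) {ε : ℝ} (hε : 0 < ε) :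
    ∃ B : ℝ, ∀ y : ℝ, 1 ≤ y → ∀ {κ : Type} [Fintype κ] (q : κ → ℕ),
      (∀ i, (q i).Prime ∧ ¬ q i ≡ 1 [MOD 4]) → Function.Injective q → ∀ J : ℕ,
        |∑ h ∈ (finite_integerPoints hC y).toFinset,
            ∏ i, levelFactor (q i) J (joinTuple o h) - y ^ k * (MeasureTheory.volume C).toReal| ≤
          B * (y ^ k * y ^ (-(2 / 3) + ε : ℝ)) := by
  set K := Fintype.card (o ⊕ Fin k) with hK
  have hK1 : 1 ≤ K := by
    rw [hK, Fintype.card_sum, Fintype.card_fin]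
    omega
  have hK0 : (0 : ℝ) < ((K ^ 2 : ℕ) : ℝ) := by positivity
  obtain ⟨A, hA, hlat⟩ := exists_abs_sum_sub_le hk hC hconv
  obtain ⟨B₁, hB₁, h₁⟩ := exists_sum_meanBox_le k ho
  -- The differences are at most (2R + 1)y, so `diffProd` is at most ((2R + 1)y)^(K²); the exponent
  -- ε/K² turns this into O(y^ε).
  obtain ⟨B₂, hB₂, h₂⟩ := exists_prod_sum_le K (div_pos hε hK0)
  obtain ⟨R, hR0, hR⟩ := hC.exists_pos_norm_le
  set V := (MeasureTheory.volume C).toReal with hV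
  have hV0 : 0 ≤ V := ENNReal.toReal_nonneg
  refine ⟨A * B₁ + (V + A) * (B₂ * (2 * R + 1) ^ ε), fun y hy κ _ q hq hinj J => ?_⟩
  have hy0 : 0 < y := by linarith
  set S := (finite_integerPoints hC y).toFinset with hS
  refine (abs_sum_prod_levelFactor_sub_le ho (fun i => (hq i).1) hinj hy hA
    (fun d hd hdy F hF => hlat d y hd hdy F hF) J).trans ?_
  have hyk : y ^ (k - 1) * y ^ (1 / 3 : ℝ) = y ^ k * y ^ (-(2 / 3) : ℝ) := by
    obtain ⟨n, rfl⟩ := Nat.exists_eq_add_of_le' hk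
    rw [Nat.add_sub_cancel, pow_succ, mul_assoc, ← Real.rpow_one_add' hy0.le (by norm_num)]
    norm_num
  have hyε : 1 ≤ y ^ ε := Real.one_le_rpow hy hε.le
  have hcard : (S.card : ℝ) ≤ (V + A) * y ^ k := by
    have h3 := hlat 1 y one_pos (by simpa using hy) (fun _ => 1) fun _ _ _ => rfl
    simp only [meanBox_const one_pos, abs_one, Finset.sum_const, nsmul_eq_mul, mul_one,
      Nat.cast_one] at h3
    have h4 : y ^ (k - 1) ≤ y ^ k := pow_le_pow_right₀ hy (Nat.sub_le _ _)
    have h5 := mul_le_mul_of_nonneg_left h4 hA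
    have h6 := (abs_le.1 h3).2
    linarith
  have hpt : ∀ h ∈ S, ∏ i, ∑ j ∈ Finset.range (J + 1), ((q i ^ j : ℕ) : ℝ) ^ (2 / 3 : ℝ) *
      |levelIncr (q i) j (joinTuple o h)| ≤ B₂ * (2 * R + 1) ^ ε * y ^ ε := by
    intro h hh
    obtain ⟨c, hc, hch⟩ := (Set.Finite.mem_toFinset _).1 hh
    have hcoord : ∀ i, (h i : ℝ) = y * c i := fun i => (congrFun hch i).symm
    obtain ⟨hcpos, hcmono⟩ := hsub hc
    have hpos : ∀ i, 0 < h i := fun i => by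
      have : (0 : ℝ) < h i := by rw [hcoord]; exact mul_pos hy0 (hcpos i)
      exact_mod_cast this
    have hinjh : Function.Injective h := by
      intro i i' e
      refine hcmono.injective (mul_left_cancel₀ hy0.ne' ?_)
      rw [← hcoord, ← hcoord, e]
    have hbd : ∀ x, |(joinTuple o h x : ℝ)| ≤ y * R := by
      rintro (⟨x, hx⟩ | i)
      · rcases ho with rfl | rfl
        · exact absurd hx (Finset.notMem_empty _)
        · rw [Finset.mem_singleton] at hx
          subst hx
          simp only [joinTuple, Sum.elim_inl, Int.cast_zero, abs_zero]
          positivity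
      · simp only [joinTuple, Sum.elim_inr]
        rw [hcoord, abs_mul, abs_of_pos hy0]
        exact mul_le_mul_of_nonneg_left ((norm_le_pi_norm c i).trans (hR c hc)) hy0.le
    have hM : ∀ x z, |((joinTuple o h x - joinTuple o h z : ℤ) : ℝ)| ≤ (2 * R + 1) * y := by
      intro x z
      push_cast
      refine (abs_sub _ _).trans ?_
      have := hbd x
      have := hbd z
      nlinarith
    have hM1 : 1 ≤ (2 * R + 1) * y := by nlinarith
    refine (h₂ q hq hinj J (joinTuple o h) rfl (injective_joinTuple ho hpos hinjh)).trans ?_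
    rw [mul_assoc, ← Real.mul_rpow (by positivity) hy0.le]
    refine mul_le_mul_of_nonneg_left ?_ hB₂
    refine (Real.rpow_le_rpow (by positivity) (natAbs_diffProd_le hM1 hM) (by positivity)).trans
      (le_of_eq ?_)
    rw [← Real.rpow_natCast, ← Real.rpow_mul (by positivity), mul_div_cancel₀ _ hK0.ne']
  have e2 : y ^ (-(2 / 3) + ε : ℝ) = y ^ (-(2 / 3) : ℝ) * y ^ ε := Real.rpow_add hy0 _ _
  have hfirst : A * y ^ (k - 1) * y ^ (1 / 3 : ℝ) * ∏ i, ∑ j ∈ Finset.range (J + 1),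
      ((q i ^ j : ℕ) : ℝ) ^ (2 / 3 : ℝ) *
        meanBox (k := k) (q i ^ j) (fun h => |levelIncr (q i) j (joinTuple o h)|) ≤
      A * B₁ * (y ^ k * y ^ (-(2 / 3) + ε : ℝ)) := by
    calc _ ≤ A * y ^ (k - 1) * y ^ (1 / 3 : ℝ) * B₁ :=
          mul_le_mul_of_nonneg_left (h₁ q hq hinj J) (by positivity)
      _ = A * B₁ * (y ^ k * y ^ (-(2 / 3) : ℝ)) * 1 := by rw [← hyk]; ring
      _ ≤ A * B₁ * (y ^ k * y ^ (-(2 / 3) : ℝ)) * y ^ ε :=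
          mul_le_mul_of_nonneg_left hyε (by positivity)
      _ = _ := by rw [e2]; ring
  have hsecond : y ^ (-(2 / 3) : ℝ) * ∑ h ∈ S, ∏ i, ∑ j ∈ Finset.range (J + 1),
      ((q i ^ j : ℕ) : ℝ) ^ (2 / 3 : ℝ) * |levelIncr (q i) j (joinTuple o h)| ≤
      (V + A) * (B₂ * (2 * R + 1) ^ ε) * (y ^ k * y ^ (-(2 / 3) + ε : ℝ)) := by
    calc _ ≤ y ^ (-(2 / 3) : ℝ) * (S.card * (B₂ * (2 * R + 1) ^ ε * y ^ ε)) := by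
          refine mul_le_mul_of_nonneg_left ?_ (by positivity)
          rw [← nsmul_eq_mul]
          exact Finset.sum_le_card_nsmul _ _ _ hpt
      _ ≤ y ^ (-(2 / 3) : ℝ) * ((V + A) * y ^ k * (B₂ * (2 * R + 1) ^ ε * y ^ ε)) := by
          gcongr
      _ = _ := by rw [e2]; ring
  refine (add_le_add hfirst hsecond).trans (le_of_eq ?_)
  ring

theorem tendsto_prod_levelFactor {ι : Type*} [Fintype ι] {T : ι → ℤ} (hT : Function.Injective T)
    (s : Finset LocalPrime) :
    Tendsto (fun J => ∏ p : s, levelFactor ((p : LocalPrime) : ℕ) J T) atTop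
      (𝓝 (∏ p ∈ s, localDensity (Finset.univ.image T) p /
        localDensity {0} p ^ (Finset.univ.image T).card)) := by
  rw [← Finset.prod_coe_sort]
  exact tendsto_finsetProd _ fun p _ => tendsto_levelFactor _ p.1.2.1 T rfl hT

/-- The truncated bound has a constant independent of the level J and of the finite set of primes.
For fixed y the sum over h is finite, so one may let J tend to infinity and then exhaust the primes.
-/
theorem exists_abs_sum_singularSeries_sub_le (hk : 1 ≤ k) {C : Set (Fin k → ℝ)}
    (hC : Bornology.IsBounded C) (hconv : Convex ℝ C) (hsub : C ⊆ orderedRegion k)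
    (ho : o = ∅ ∨ o = {0}) {ε : ℝ} (hε : 0 < ε) :
    ∃ B : ℝ, ∀ y : ℝ, 1 ≤ y →
      |∑ h ∈ (finite_integerPoints hC y).toFinset, singularSeries (o ∪ Finset.univ.image h) -
          y ^ k * (MeasureTheory.volume C).toReal| ≤ B * (y ^ k * y ^ (-(2 / 3) + ε : ℝ)) := by
  obtain ⟨B, hB⟩ := exists_abs_sum_prod_levelFactor_sub_le hk hC hconv hsub ho hε
  refine ⟨B, fun y hy => ?_⟩
  have hy0 : 0 < y := by linarith
  have hinj : ∀ h ∈ (finite_integerPoints hC y).toFinset,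
      Function.Injective (joinTuple o h) := by
    intro h hh
    obtain ⟨c, hc, hch⟩ := (Set.Finite.mem_toFinset _).1 hh
    have hcoord : ∀ i, (h i : ℝ) = y * c i := fun i => (congrFun hch i).symm
    obtain ⟨hcpos, hcmono⟩ := hsub hc
    refine injective_joinTuple ho (fun i => ?_) fun i i' e => ?_
    · have : (0 : ℝ) < h i := by rw [hcoord]; exact mul_pos hy0 (hcpos i)
      exact_mod_cast this
    · refine hcmono.injective (mul_left_cancel₀ hy0.ne' ?_)
      rw [← hcoord, ← hcoord, e]
  have hT : ∀ s : Finset LocalPrime,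
      |∑ h ∈ (finite_integerPoints hC y).toFinset, ∏ p ∈ s,
          localDensity (Finset.univ.image (joinTuple o h)) p /
            localDensity {0} p ^ (Finset.univ.image (joinTuple o h)).card -
          y ^ k * (MeasureTheory.volume C).toReal| ≤ B * (y ^ k * y ^ (-(2 / 3) + ε : ℝ)) := by
    intro s
    refine le_of_tendsto' (((tendsto_finsetSum _ fun h hh =>
      tendsto_prod_levelFactor (hinj h hh) s).sub_const _).abs) fun J => ?_
    exact hB y hy (fun p : s => ((p : LocalPrime) : ℕ)) (fun p => p.1.2)
      (Subtype.val_injective.comp Subtype.val_injective) J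
  simp only [← image_joinTuple]
  have hprod : ∀ H : Finset ℤ, Tendsto (fun s : Finset LocalPrime => ∏ p ∈ s,
      localDensity H p / localDensity {0} p ^ H.card) atTop (𝓝 (singularSeries H)) :=
    fun H => (multipliable_localFactor H).hasProd
  exact le_of_tendsto' (((tendsto_finsetSum _ fun h _ => hprod _).sub_const _).abs) hT

end Average

/-- A quantity that is `O(y ^ (a + ε))` for every `ε > 0` is `O(y ^ (a + o(1)))`. -/
theorem exists_isBigO_rpow_add {a : ℝ} {E : ℝ → ℝ}
    (h : ∀ ε : ℝ, 0 < ε → ∃ B : ℝ, ∀ y : ℝ, 1 ≤ y → |E y| ≤ B * y ^ (a + ε)) :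
    ∃ η : ℝ → ℝ, Tendsto η atTop (𝓝 0) ∧ E =O[atTop] fun y => y ^ (a + η y) := by
  set m : ℝ → ℝ := fun y => max (|E y| * y ^ (-a)) 1 with hm
  have hm1 : ∀ y, 1 ≤ m y := fun y => le_max_right _ _
  -- This η satisfies y^(η y) = m y exactly for y > 1. The truncation of m at 1 makes η nonnegative
  -- there, and the hypothesis with ε/2 makes it eventually smaller than ε.
  refine ⟨fun y => Real.log (m y) / Real.log y, ?_, ?_⟩
  · rw [Metric.tendsto_atTop]
    intro ε hε
    obtain ⟨B, hB⟩ := h (ε / 2) (by positivity)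
    set D := max B 1 with hD
    have hD1 : 1 ≤ D := le_max_right _ _
    obtain ⟨Y, hY⟩ := (tendsto_atTop.1 Real.tendsto_log_atTop
      (2 / ε * (Real.log D + 1))).exists_forall_of_atTop
    refine ⟨max Y 2, fun y hy => ?_⟩
    have hy2 : 2 ≤ y := (le_max_right _ _).trans hy
    have hy0 : 0 < y := by linarith
    have hlog : 0 < Real.log y := Real.log_pos (by linarith)
    have hmy : m y ≤ D * y ^ (ε / 2) := by
      have h1 : 1 ≤ y ^ (ε / 2) := Real.one_le_rpow (by linarith) (by positivity)
      refine max_le ?_ (by nlinarith)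
      calc |E y| * y ^ (-a) ≤ B * y ^ (a + ε / 2) * y ^ (-a) := by
            gcongr
            exact hB y (by linarith)
        _ = B * y ^ (ε / 2) := by
            rw [mul_assoc, ← Real.rpow_add hy0]
            congr 2
            ring
        _ ≤ _ := by gcongr; exact le_max_left _ _
    have h2 : Real.log (m y) ≤ Real.log D + ε / 2 * Real.log y := by
      rw [← Real.log_rpow hy0, ← Real.log_mul (by positivity) (by positivity)]
      exact Real.log_le_log (by linarith [hm1 y]) hmy
    have h3 := hY y ((le_max_left _ _).trans hy)
    have h4 : Real.log D + 1 ≤ ε / 2 * Real.log y := by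
      have := mul_le_mul_of_nonneg_left h3 (by positivity : 0 ≤ ε / 2)
      calc Real.log D + 1 = ε / 2 * (2 / ε * (Real.log D + 1)) := by field_simp
        _ ≤ _ := this
    rw [Real.dist_eq, sub_zero, abs_of_nonneg (div_nonneg (Real.log_nonneg (hm1 y)) hlog.le),
      div_lt_iff₀ hlog]
    linarith
  · refine Asymptotics.IsBigO.of_bound 1 ((eventually_ge_atTop 2).mono fun y hy => ?_)
    have hy0 : 0 < y := by linarith
    have hlog : 0 < Real.log y := Real.log_pos (by linarith)
    have hmy : y ^ (Real.log (m y) / Real.log y) = m y := by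
      rw [Real.rpow_def_of_pos hy0, mul_div_cancel₀ _ hlog.ne', Real.exp_log]
      linarith [hm1 y]
    rw [one_mul, Real.norm_eq_abs, Real.norm_eq_abs, abs_of_pos (Real.rpow_pos_of_pos hy0 _),
      Real.rpow_add hy0, hmy]
    calc |E y| = y ^ a * (|E y| * y ^ (-a)) := by
          rw [mul_left_comm, ← Real.rpow_add hy0, add_neg_cancel, Real.rpow_zero, mul_one]
      _ ≤ _ := by
          gcongr
          exact le_max_left _ _

end TwoSquares

theorem proposition1p2 (k : ℕ) (hk : 1 ≤ k) (C : Set (Fin k → ℝ))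
    (hCbdd : Bornology.IsBounded C) (hCconv : Convex ℝ C)
    (hCsub : C ⊆ TwoSquares.orderedRegion k)
    (o : Finset ℤ) (ho : o = ∅ ∨ o = {0}) :
    ∃ η E : ℝ → ℝ,
      Tendsto η atTop (𝓝 0) ∧
      E =O[atTop] (fun y : ℝ => y ^ (-(2 / 3 : ℝ) + η y)) ∧
      ∀ᶠ y : ℝ in atTop,
        ∑ᶠ h ∈ TwoSquares.integerPoints (y • C),
            TwoSquares.singularSeries (o ∪ Finset.univ.image h) =
          y ^ k * ((MeasureTheory.volume C).toReal + E y) := by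
  set V := (MeasureTheory.volume C).toReal
  set E : ℝ → ℝ := fun y => (∑ h ∈ (TwoSquares.finite_integerPoints hCbdd y).toFinset,
    TwoSquares.singularSeries (o ∪ Finset.univ.image h) - y ^ k * V) / y ^ k with hE
  obtain ⟨η, h1, h2⟩ := TwoSquares.exists_isBigO_rpow_add (a := -(2 / 3)) (E := E) fun ε hε => by
    obtain ⟨B, hB⟩ :=
      TwoSquares.exists_abs_sum_singularSeries_sub_le hk hCbdd hCconv hCsub ho hε
    refine ⟨B, fun y hy => ?_⟩
    have hyk : 0 < y ^ k := by positivity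
    rw [hE, abs_div, abs_of_pos hyk, div_le_iff₀ hyk]
    refine (hB y hy).trans (le_of_eq ?_)
    ring
  refine ⟨η, E, h1, h2, (eventually_gt_atTop 0).mono fun y hy => ?_⟩
  have hyk : y ^ k ≠ 0 := by positivity
  rw [finsum_mem_eq_finite_toFinset_sum _ (TwoSquares.finite_integerPoints hCbdd y), hE]
  field_simp
  ring
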